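/- Let $d\ge 4$. Let $J_\nu$ denote the Bessel function of the first kind, $J_\nu(t)=\frac{t^\nu}{2^\nu\,\Gamma(\nu+\frac12)\sqrt\pi}\int_{-1}^1 e^{its}(1-s^2)^{\nu-\frac12}\,ds$ for $t\ge 0$, and define $m\colon[0,\infty)\to\mathbb C$ by $$m(x)=\frac{2^{d/2}\,\Gamma\!\left(\frac{d+1}{2}\right)}{\sqrt\pi}\int_{2\pi x}^\infty r^{-d/2}J_{d/2}(r)\,dr .$$ With the Fourier transform $\widehat f(\xi)=\int_{\mathbb R^d}f(x)e^{-2\pi i x\cdot\xi}\,dx$ (extended to an isometry of $L^2(\mathbb R^d)$), let $M^t$, $t>0$, be the operator on the complex space $L^2(\mathbb R^d)$ given by $\widehat{M^tf}(\xi)=m(t|\xi|)\,\widehat f(\xi)$. (i) For every $f\in L^2(\mathbb R^d)$ one can choose representatives of the classes $M^tf$, $t>0$, such that for almost every $x$ the map $t\mapsto M^tf(x)$ is continuous on $(0,\infty)$. For a Schwartz function $f$ such representatives are given by $M^tf(x)=\int_{\mathbb R^d}m(t|\xi|)\widehat f(\xi)e^{2\pi i x\cdot\xi}\,d\xi$.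 (ii) Put $M^*f(x)=\sup_{t>0}|M^tf(x)|$, computed from any choice of representatives as in (i); the choice affects $M^*f$ only on a null set. Then for every $f\in L^2(\mathbb R^d)$ the function $M^*f$ is measurable (with respect to the completed Lebesgue measure) and $$\|M^*f\|_{L^2(\mathbb R^d)}\le 2\cdot 10^8\,\|f\|_{L^2(\mathbb R^d)} .$$ -/

import Mathlib

open MeasureTheory FourierTransform
open scoped ENNReal SchwartzMap

noncomputable section

namespace RieszMaximal

/-- The Bessel function of the first kind `J_ν(t)`, for `ν > -1/2` and `t ≥ 0`,
given by Poisson's integral representation. -/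
def besselJ (ν t : ℝ) : ℂ :=
  ((t ^ ν / (2 ^ ν * Real.Gamma (ν + 1 / 2) * √Real.pi) : ℝ) : ℂ) *
    ∫ s in (-1 : ℝ)..1, Complex.exp (Complex.I * t * s) * (((1 - s ^ 2) ^ (ν - 1 / 2) : ℝ) : ℂ)

/-- The radial profile
`m(x) = 2^{d/2} Γ((d+1)/2) π^{-1/2} ∫_{2πx}^∞ r^{-d/2} J_{d/2}(r) dr`, for `x ≥ 0`. -/
def profile (d : ℕ) (x : ℝ) : ℂ :=
  ((2 ^ ((d : ℝ) / 2) * Real.Gamma (((d : ℝ) + 1) / 2) / √Real.pi : ℝ) : ℂ) *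
    ∫ r in Set.Ioi (2 * Real.pi * x),
      ((r ^ (-((d : ℝ) / 2)) : ℝ) : ℂ) * besselJ ((d : ℝ) / 2) r

theorem measurable_besselJ (ν : ℝ) : Measurable (besselJ ν) := by
  unfold besselJ
  refine Measurable.mul (by fun_prop) ?_
  simp only [intervalIntegral.integral_of_le (show (-1 : ℝ) ≤ 1 by norm_num)]
  refine StronglyMeasurable.measurable ?_
  refine StronglyMeasurable.integral_prod_right
    (f := fun t s : ℝ => Complex.exp (Complex.I * t * s) *
      (((1 - s ^ 2) ^ (ν - 1 / 2) : ℝ) : ℂ)) ?_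
  refine Measurable.stronglyMeasurable ?_
  simp only [Function.uncurry_def]
  fun_prop

theorem measurable_profile (d : ℕ) : Measurable (profile d) := by
  unfold profile
  refine Measurable.mul measurable_const ?_
  have h : Measurable fun r : ℝ =>
      ((r ^ (-((d : ℝ) / 2)) : ℝ) : ℂ) * besselJ ((d : ℝ) / 2) r :=
    Measurable.mul (by fun_prop) (measurable_besselJ _)
  simp only [← integral_indicator (measurableSet_Ioi)]
  refine StronglyMeasurable.measurable ?_
  refine StronglyMeasurable.integral_prod_right
    (f := fun x r : ℝ => (Set.Ioi (2 * Real.pi * x)).indicator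
      (fun r : ℝ => ((r ^ (-((d : ℝ) / 2)) : ℝ) : ℂ) * besselJ ((d : ℝ) / 2) r) r) ?_
  refine Measurable.stronglyMeasurable ?_
  have hs : MeasurableSet {p : ℝ × ℝ | 2 * Real.pi * p.1 < p.2} :=
    measurableSet_lt (by fun_prop) (by fun_prop)
  exact (h.comp measurable_snd).indicator hs

theorem norm_integrand_le (d : ℕ) : ∃ C : ℝ, ∀ r : ℝ, 0 < r →
    ‖((r ^ (-((d : ℝ) / 2)) : ℝ) : ℂ) * besselJ ((d : ℝ) / 2) r‖ ≤ C := by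
  set ν : ℝ := (d : ℝ) / 2
  refine ⟨|(2 ^ ν * Real.Gamma (ν + 1 / 2) * √Real.pi)⁻¹| *
    ∫ s in (-1 : ℝ)..1, |(1 - s ^ 2) ^ (ν - 1 / 2)|, fun r hr => ?_⟩
  have h1 : ‖∫ s in (-1 : ℝ)..1, Complex.exp (Complex.I * r * s) *
      (((1 - s ^ 2) ^ (ν - 1 / 2) : ℝ) : ℂ)‖ ≤
      ∫ s in (-1 : ℝ)..1, |(1 - s ^ 2) ^ (ν - 1 / 2)| := by
    refine (intervalIntegral.norm_integral_le_integral_norm (by norm_num)).trans (le_of_eq ?_)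
    refine intervalIntegral.integral_congr fun s _ => ?_
    have : Complex.I * (r : ℂ) * (s : ℂ) = ((r * s : ℝ) : ℂ) * Complex.I := by
      push_cast; ring
    simp only [norm_mul, this, Complex.norm_exp_ofReal_mul_I, one_mul, Complex.norm_real,
      Real.norm_eq_abs]
  unfold besselJ
  rw [← mul_assoc, ← Complex.ofReal_mul, norm_mul, Complex.norm_real, Real.norm_eq_abs]
  have h2 : r ^ (-ν) * (r ^ ν / (2 ^ ν * Real.Gamma (ν + 1 / 2) * √Real.pi)) =
      (2 ^ ν * Real.Gamma (ν + 1 / 2) * √Real.pi)⁻¹ := by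
    rw [← mul_div_assoc, ← Real.rpow_add hr]
    simp
  rw [h2]
  exact mul_le_mul_of_nonneg_left h1 (abs_nonneg _)

theorem norm_profile_le (d : ℕ) : ∃ C : ℝ, ∀ x : ℝ, 0 ≤ x → ‖profile d x‖ ≤ C := by
  set g : ℝ → ℂ := fun r => ((r ^ (-((d : ℝ) / 2)) : ℝ) : ℂ) * besselJ ((d : ℝ) / 2) r
  have hg : Measurable g := Measurable.mul (by fun_prop) (measurable_besselJ _)
  obtain ⟨C, hC⟩ := norm_integrand_le d
  set A : ℂ := ((2 ^ ((d : ℝ) / 2) * Real.Gamma (((d : ℝ) + 1) / 2) / √Real.pi : ℝ) : ℂ)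
  refine ⟨‖A‖ * ∫ r in Set.Ioi (0 : ℝ), ‖g r‖, fun x hx => ?_⟩
  have hx' : 0 ≤ 2 * Real.pi * x := by positivity
  have key : ‖∫ r in Set.Ioi (2 * Real.pi * x), g r‖ ≤ ∫ r in Set.Ioi (0 : ℝ), ‖g r‖ := by
    by_cases hi : IntegrableOn g (Set.Ioi (2 * Real.pi * x))
    · have h0 : IntegrableOn g (Set.Ioc 0 (2 * Real.pi * x)) := by
        refine IntegrableOn.of_bound (by simp) hg.aestronglyMeasurable C ?_
        filter_upwards [ae_restrict_mem measurableSet_Ioc] with r hr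
        exact hC r hr.1
      have hI : IntegrableOn g (Set.Ioi 0) := by
        rw [← Set.Ioc_union_Ioi_eq_Ioi hx']
        exact h0.union hi
      refine (norm_integral_le_integral_norm _).trans ?_
      exact setIntegral_mono_set hI.norm (Filter.Eventually.of_forall fun _ => norm_nonneg _)
        (Set.Ioi_subset_Ioi hx').eventuallyLE
    · rw [integral_undef hi, norm_zero]
      exact integral_nonneg fun _ => norm_nonneg _
  unfold profile
  rw [norm_mul]
  exact mul_le_mul_of_nonneg_left key (norm_nonneg _)

variable {d : ℕ}

/-- The symbol `ξ ↦ m(t|ξ|)`, `t > 0`, is a bounded measurable function on `ℝ^d`. -/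
theorem memLp_symbol (t : Set.Ioi (0 : ℝ)) :
    MemLp (fun ξ : EuclideanSpace ℝ (Fin d) => profile d (t * ‖ξ‖)) ∞ volume := by
  obtain ⟨C, hC⟩ := norm_profile_le d
  refine memLp_top_of_bound ?_ C (Filter.Eventually.of_forall fun ξ => ?_)
  · exact ((measurable_profile d).comp (by fun_prop)).aestronglyMeasurable
  · exact hC _ (mul_nonneg (le_of_lt t.2) (norm_nonneg ξ))

/-- The operator `M^t` on `L²(ℝ^d)`: the inverse Fourier transform of the product of `m(t|ξ|)`
and the `L²` Fourier transform of `f`. -/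
def multiplierOp (t : Set.Ioi (0 : ℝ)) (f : Lp ℂ 2 (volume : Measure (EuclideanSpace ℝ (Fin d)))) :
    Lp ℂ 2 (volume : Measure (EuclideanSpace ℝ (Fin d))) :=
  let symbol : Lp ℂ ∞ (volume : Measure (EuclideanSpace ℝ (Fin d))) := (memLp_symbol t).toLp _
  let product : Lp ℂ 2 (volume : Measure (EuclideanSpace ℝ (Fin d))) := symbol • 𝓕 f
  𝓕⁻ product

theorem fourier_multiplierOp (t : Set.Ioi (0 : ℝ))
    (f : Lp ℂ 2 (volume : Measure (EuclideanSpace ℝ (Fin d)))) :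
    (𝓕 (multiplierOp t f) : Lp ℂ 2 (volume : Measure (EuclideanSpace ℝ (Fin d)))) =ᵐ[volume]
      fun ξ => profile d (t * ‖ξ‖) *
        (𝓕 f : Lp ℂ 2 (volume : Measure (EuclideanSpace ℝ (Fin d)))) ξ := by
  unfold multiplierOp
  rw [fourier_fourierInv_eq]
  refine (Lp.coeFn_lpSMul _ _).trans ?_
  filter_upwards [(memLp_symbol (d := d) t).coeFn_toLp] with ξ h
  rw [Pi.smul_apply', h, smul_eq_mul]

/-- `F` is a choice of representatives `F t` of the classes `M^t f`, `t > 0`, for which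
`t ↦ F t x` is continuous for almost every `x`. Two such choices agree, for almost every `x`,
at all `t > 0` simultaneously. -/
structure IsContinuousVersion (f : Lp ℂ 2 (volume : Measure (EuclideanSpace ℝ (Fin d))))
    (F : Set.Ioi (0 : ℝ) → EuclideanSpace ℝ (Fin d) → ℂ) : Prop where
  ae_eq : ∀ t, F t =ᵐ[volume] multiplierOp t f
  continuous : ∀ᵐ x, Continuous fun t => F t x

/-- For a Schwartz function `φ`, the pointwise value
`M^t φ(x) = ∫ m(t|ξ|) φ̂(ξ) e^{2πi x·ξ} dξ`. -/
def schwartzValue (φ : 𝓢(EuclideanSpace ℝ (Fin d), ℂ)) (t : Set.Ioi (0 : ℝ))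
    (x : EuclideanSpace ℝ (Fin d)) : ℂ :=
  𝓕⁻ (fun ξ : EuclideanSpace ℝ (Fin d) => profile d (t * ‖ξ‖) * 𝓕 φ ξ) x

/-- The maximal function `x ↦ sup_{t > 0} |F t x|`. -/
def maximalFunction (F : Set.Ioi (0 : ℝ) → EuclideanSpace ℝ (Fin d) → ℂ)
    (x : EuclideanSpace ℝ (Fin d)) : ℝ≥0∞ :=
  ⨆ t, ‖F t x‖ₑ

end RieszMaximal

end

/-! Substituting s = sin θ in Poisson's integral gives m(x) = π⁻¹ ∫_{2πx}^∞ B(r) dr, where B(r) = ∫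
e^{ir sin θ} cos^d θ dθ. Two integrations by parts and Wallis' recursion show |B(r)| ≤ (8/D)/(1 +
(r/D)²) with D = √(2d). After rescaling by D, the size, tail and derivative of m are therefore
bounded by absolute constants, and this is the only place where the dimension matters.

Write m(x) = m(0)/(1 + (cx)²) + b(x) with c = 2π/D. The remainder b satisfies |b(x)| + x|b'(x)| ≲
cx/(1 + (cx)²), so it is small both at 0 and at infinity. Hence sup_t |b(t|∇|)f|² is at most a
square function (`enorm_radialOp_sq_le`), whose integral is computed by Plancherel
(`lintegral_squareFunction_le`).

The first term is a resolvent of the Laplacian, an exponential average of heat operators, hence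
given by a positive symmetric kernel of mass 1. Up to a factor 2 only dyadic parameters matter. For
these kernels K_i K_j ≤ 4 K_{i+1} when j ≤ i (`lintegral_resolventKernel_mul_le`). This composition
law alone yields the L² maximal inequality: linearise the supremum, expand the square of the
adjoint, and note that the maximal function reappears with a coefficient that can be absorbed
(`lintegral_kernelMax_sq_le`).

Together these give the bound 100 for Schwartz functions. A rapidly convergent Schwartz
approximation then makes the values converge uniformly in t for almost every x, which produces the
continuous version, and Fatou's lemma carries the bound over to L². -/

noncomputable section

namespace RieszMaximal

/-! ### Bessel integrals -/

/-- The integral `∫ cos^n` over a half period. -/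
def cosPow (n : ℕ) : ℝ := ∫ θ in -(Real.pi / 2)..(Real.pi / 2), Real.cos θ ^ n

theorem cosPow_add_two (n : ℕ) : (n + 2) * cosPow (n + 2) = (n + 1) * cosPow n := by
  unfold cosPow
  rw [integral_cos_pow]
  have h : (n : ℝ) + 2 ≠ 0 := by positivity
  simp only [Real.cos_pi_div_two, Real.cos_neg]
  field_simp
  simp

theorem cosPow_nonneg (n : ℕ) : 0 ≤ cosPow n := by
  refine intervalIntegral.integral_nonneg (by linarith [Real.pi_pos]) fun θ hθ => ?_
  exact pow_nonneg (Real.cos_nonneg_of_mem_Icc hθ) n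

theorem cosPow_succ_le (n : ℕ) : cosPow (n + 1) ≤ cosPow n := by
  refine intervalIntegral.integral_mono_on (by linarith [Real.pi_pos])
    (Continuous.intervalIntegrable (by fun_prop) _ _)
    (Continuous.intervalIntegrable (by fun_prop) _ _) fun θ hθ => ?_
  exact pow_le_pow_of_le_one (Real.cos_nonneg_of_mem_Icc hθ) (Real.cos_le_one θ) n.le_succ

/-- By the Wallis recursion the left side does not depend on n, and at n = 0 it is π · 2. -/
theorem cosPow_mul_cosPow_succ (n : ℕ) :
    (n + 1) * (cosPow n * cosPow (n + 1)) = 2 * Real.pi := by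
  induction n with
  | zero =>
    simp [cosPow]
    ring
  | succ n ih =>
    rw [← ih]
    have h := cosPow_add_two n
    push_cast
    linear_combination cosPow (n + 1) * h

theorem cosPow_sq_le (n : ℕ) : n * cosPow n ^ 2 ≤ 2 * Real.pi := by
  rcases n with _ | n
  · simp [Real.pi_pos.le]
  · rw [← cosPow_mul_cosPow_succ n]
    push_cast
    rw [sq]
    have := mul_le_mul_of_nonneg_right (cosPow_succ_le n) (cosPow_nonneg (n + 1))
    exact mul_le_mul_of_nonneg_left this (by positivity)

/-- The integral `∫ e^{ir sin θ} cos^n θ dθ`, proportional to `r^{-n/2} J_{n/2}(r)`. -/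
def besselInt (n : ℕ) (r : ℝ) : ℂ :=
  ∫ θ in -(Real.pi / 2)..(Real.pi / 2),
    Complex.exp (Complex.I * r * Real.sin θ) * ((Real.cos θ ^ n : ℝ) : ℂ)

theorem norm_exp_I_mul_mul (r s : ℝ) : ‖Complex.exp (Complex.I * r * s)‖ = 1 := by
  rw [show Complex.I * (r : ℂ) * (s : ℂ) = ((r * s : ℝ) : ℂ) * Complex.I by push_cast; ring,
    Complex.norm_exp_ofReal_mul_I]

theorem continuous_besselInt (n : ℕ) : Continuous (besselInt n) := by
  unfold besselInt
  exact intervalIntegral.continuous_parametric_intervalIntegral_of_continuous' (by fun_prop) _ _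

theorem norm_besselInt_le (n : ℕ) (r : ℝ) : ‖besselInt n r‖ ≤ cosPow n := by
  have hp : -(Real.pi / 2) ≤ Real.pi / 2 := by linarith [Real.pi_pos]
  refine (intervalIntegral.norm_integral_le_integral_norm hp).trans (le_of_eq ?_)
  refine intervalIntegral.integral_congr fun θ hθ => ?_
  rw [Set.uIcc_of_le hp] at hθ
  simp only [norm_mul, norm_exp_I_mul_mul, one_mul, Complex.norm_real, Real.norm_eq_abs]
  exact abs_of_nonneg (pow_nonneg (Real.cos_nonneg_of_mem_Icc hθ) n)

/-- Two integrations by parts, packaged as one explicit primitive. Its boundary values vanish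
because both terms contain a positive power of cos θ. The exponent k + 4 leaves the power cos^k
inside, which is where d ≥ 4 is used. -/
theorem sq_mul_besselInt (k : ℕ) (r : ℝ) :
    (r : ℂ) ^ 2 * besselInt (k + 4) r = (k + 3) * ∫ θ in -(Real.pi / 2)..(Real.pi / 2),
      Complex.exp (Complex.I * r * Real.sin θ) *
        ((Real.cos θ ^ (k + 2) - (k + 1) * Real.sin θ ^ 2 * Real.cos θ ^ k : ℝ) : ℂ) := by
  set e : ℝ → ℂ := fun θ => Complex.exp (Complex.I * r * Real.sin θ)
  have he : Continuous e := by fun_prop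
  have hsin (θ : ℝ) : HasDerivAt (fun θ : ℝ => ((Real.sin θ : ℝ) : ℂ)) (Real.cos θ : ℂ) θ :=
    (Real.hasDerivAt_sin θ).ofReal_comp
  have hcos (θ : ℝ) : HasDerivAt (fun θ : ℝ => ((Real.cos θ : ℝ) : ℂ)) (-Real.sin θ : ℂ) θ := by
    simpa using (Real.hasDerivAt_cos θ).ofReal_comp
  have hde (θ : ℝ) : HasDerivAt e (e θ * (Complex.I * r * Real.cos θ)) θ :=
    ((hsin θ).const_mul (Complex.I * (r : ℂ))).cexp
  have hG (θ : ℝ) : HasDerivAt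
      (fun θ => -Complex.I * r * (e θ * (Real.cos θ : ℂ) ^ (k + 3)) -
        (k + 3) * (e θ * Real.sin θ * (Real.cos θ : ℂ) ^ (k + 1)))
      ((r : ℂ) ^ 2 * (e θ * ((Real.cos θ ^ (k + 4) : ℝ) : ℂ)) - (k + 3) * (e θ *
        ((Real.cos θ ^ (k + 2) - (k + 1) * Real.sin θ ^ 2 * Real.cos θ ^ k : ℝ) : ℂ))) θ := by
    have h1 := (((hde θ).mul ((hcos θ).pow (k + 3))).const_mul (-Complex.I * (r : ℂ))).sub
      ((((hde θ).mul (hsin θ)).mul ((hcos θ).pow (k + 1))).const_mul ((k : ℂ) + 3))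
    convert! h1 using 1
    simp only [Pi.mul_apply, Pi.pow_apply, Nat.add_sub_cancel, show k + 3 - 1 = k + 2 from rfl]
    push_cast
    ring_nf
    simp only [Complex.I_sq]
    ring
  have hint := intervalIntegral.integral_eq_sub_of_hasDerivAt
    (a := -(Real.pi / 2)) (b := Real.pi / 2) (fun θ _ => hG θ)
    (Continuous.intervalIntegrable (by fun_prop) _ _)
  rw [intervalIntegral.integral_sub (Continuous.intervalIntegrable (by fun_prop) _ _)
    (Continuous.intervalIntegrable (by fun_prop) _ _), intervalIntegral.integral_const_mul,
    intervalIntegral.integral_const_mul] at hint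
  simp only [Real.cos_neg, Real.cos_pi_div_two, Complex.ofReal_zero, zero_pow (Nat.succ_ne_zero _),
    mul_zero, sub_self] at hint
  exact sub_eq_zero.mp hint

/-- Taking absolute values inside the integral and using sin² = 1 - cos² leaves (k+1)c_k - k
c_{k+2}, where c_n is `cosPow n`. The recursion turns this into 2c_{k+2}, and (k+3)c_{k+2} =
(k+4)c_{k+4}. -/
theorem sq_mul_norm_besselInt_le (k : ℕ) (r : ℝ) :
    r ^ 2 * ‖besselInt (k + 4) r‖ ≤ 2 * (k + 4) * cosPow (k + 4) := by
  have hp : -(Real.pi / 2) ≤ Real.pi / 2 := by linarith [Real.pi_pos]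
  have h0 : r ^ 2 * ‖besselInt (k + 4) r‖ = ‖(r : ℂ) ^ 2 * besselInt (k + 4) r‖ := by
    rw [norm_mul, norm_pow, Complex.norm_real, Real.norm_eq_abs, sq_abs]
  have h1 : ‖∫ θ in -(Real.pi / 2)..(Real.pi / 2), Complex.exp (Complex.I * r * Real.sin θ) *
        ((Real.cos θ ^ (k + 2) - (k + 1) * Real.sin θ ^ 2 * Real.cos θ ^ k : ℝ) : ℂ)‖ ≤
      ∫ θ in -(Real.pi / 2)..(Real.pi / 2), ((k + 1) * Real.cos θ ^ k
        - k * Real.cos θ ^ (k + 2)) := by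
    refine intervalIntegral.norm_integral_le_of_norm_le hp
      (Filter.Eventually.of_forall fun θ hθ => ?_)
      (Continuous.intervalIntegrable (by fun_prop) _ _)
    have hc : 0 ≤ Real.cos θ := Real.cos_nonneg_of_mem_Icc ⟨hθ.1.le, hθ.2⟩
    rw [norm_mul, norm_exp_I_mul_mul, one_mul, Complex.norm_real, Real.norm_eq_abs]
    refine (abs_sub _ _).trans (le_of_eq ?_)
    rw [abs_of_nonneg (by positivity), abs_of_nonneg (by positivity), Real.sin_sq]
    ring
  rw [intervalIntegral.integral_sub (Continuous.intervalIntegrable (by fun_prop) _ _)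
    (Continuous.intervalIntegrable (by fun_prop) _ _), intervalIntegral.integral_const_mul,
    intervalIntegral.integral_const_mul] at h1
  change _ ≤ ((k : ℝ) + 1) * cosPow k - k * cosPow (k + 2) at h1
  have h2 := cosPow_add_two k
  have h3 := cosPow_add_two (k + 2)
  push_cast at h3
  rw [h0, sq_mul_besselInt, norm_mul,
    show ((k : ℂ) + 3) = ((k + 3 : ℝ) : ℂ) by push_cast; rfl, Complex.norm_real,
    Real.norm_of_nonneg (by positivity)]
  calc ((k : ℝ) + 3) * _ ≤ (k + 3) * (((k : ℝ) + 1) * cosPow k - k * cosPow (k + 2)) :=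
        mul_le_mul_of_nonneg_left h1 (by positivity)
    _ = 2 * (k + 4) * cosPow (k + 4) := by linear_combination -(k + 3 : ℝ) * h2 - 2 * h3

/-- The natural length scale `√(2d)` of the profile. -/
def scale (d : ℕ) : ℝ := √(2 * d)

theorem scale_sq (d : ℕ) : scale d ^ 2 = 2 * d := Real.sq_sqrt (by positivity)

theorem scale_pos {d : ℕ} (hd : 4 ≤ d) : 0 < scale d :=
  Real.sqrt_pos.mpr (by have : 0 < d := by omega
                        positivity)

/-- Both the trivial bound for B and the decay bound for (r/D)²B equal `cosPow d`, because D² = 2d.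
They are added, and `cosPow d` ≤ 4/D follows from 2d · `cosPow d`² ≤ 4π ≤ 16. -/
theorem norm_besselInt_le_div {d : ℕ} (hd : 4 ≤ d) (r : ℝ) :
    ‖besselInt d r‖ ≤ (8 / scale d) / (1 + (r / scale d) ^ 2) := by
  have hD := scale_pos hd
  have hDsq := scale_sq d
  have hc : cosPow d ≤ 4 / scale d := by
    have h1 : (scale d * cosPow d) ^ 2 ≤ 4 ^ 2 := by
      have := cosPow_sq_le d
      rw [mul_pow, hDsq]
      nlinarith [Real.pi_lt_four]
    rw [le_div_iff₀ hD, mul_comm]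
    exact le_of_sq_le_sq h1 (by norm_num)
  have h1 := norm_besselInt_le d r
  have h2 : r ^ 2 * ‖besselInt d r‖ ≤ 2 * d * cosPow d := by
    obtain ⟨k, rfl⟩ := Nat.exists_eq_add_of_le' hd
    simpa using sq_mul_norm_besselInt_le k r
  rw [le_div_iff₀ (by positivity)]
  rw [← hDsq] at h2
  have h3 : ‖besselInt d r‖ * (r / scale d) ^ 2 ≤ cosPow d := by
    rw [div_pow, mul_div_assoc', div_le_iff₀ (by positivity)]
    linarith
  calc _ = ‖besselInt d r‖ + ‖besselInt d r‖ * (r / scale d) ^ 2 := by ring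
    _ ≤ 4 / scale d + 4 / scale d := by linarith
    _ = 8 / scale d := by ring

/-- Substitution s = sin θ: the weight (1 - s²)^{(d-1)/2} becomes cos^{d-1} θ and ds supplies the
remaining cosine. -/
theorem bessel_eq_besselInt (d : ℕ) (hd : 1 ≤ d) {r : ℝ} (hr : 0 < r) :
    ((r ^ (-((d : ℝ) / 2)) : ℝ) : ℂ) * besselJ ((d : ℝ) / 2) r =
      (((2 ^ ((d : ℝ) / 2) * Real.Gamma (((d : ℝ) + 1) / 2) * √Real.pi)⁻¹ : ℝ) : ℂ) *
        besselInt d r := by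
  have h1 : (∫ s in (-1 : ℝ)..1, Complex.exp (Complex.I * r * s) *
      (((1 - s ^ 2) ^ ((d : ℝ) / 2 - 1 / 2) : ℝ) : ℂ)) = besselInt d r := by
    have hexp : 0 ≤ (d : ℝ) / 2 - 1 / 2 := by
      have : (1 : ℝ) ≤ d := by exact_mod_cast hd
      linarith
    have hcont : Continuous fun s : ℝ => Complex.exp (Complex.I * r * s) *
        (((1 - s ^ 2) ^ ((d : ℝ) / 2 - 1 / 2) : ℝ) : ℂ) := by
      have : Continuous fun s : ℝ => (1 - s ^ 2) ^ ((d : ℝ) / 2 - 1 / 2) :=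
        Continuous.rpow_const (by fun_prop) fun s => Or.inr hexp
      fun_prop
    have h := intervalIntegral.integral_deriv_smul_comp (a := -(Real.pi / 2)) (b := Real.pi / 2)
      (f := Real.sin) (f' := Real.cos) (fun x _ => Real.hasDerivAt_sin x)
      Real.continuous_cos.continuousOn hcont
    rw [Real.sin_neg, Real.sin_pi_div_two] at h
    rw [← h]
    refine intervalIntegral.integral_congr fun θ hθ => ?_
    rw [Set.uIcc_of_le (by linarith [Real.pi_pos])] at hθ
    have hc : 0 ≤ Real.cos θ := Real.cos_nonneg_of_mem_Icc hθ
    have h2 : (1 - Real.sin θ ^ 2) ^ ((d : ℝ) / 2 - 1 / 2) = Real.cos θ ^ (d - 1) := by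
      rw [← Real.cos_sq', ← Real.rpow_natCast (Real.cos θ) 2, ← Real.rpow_mul hc,
        ← Real.rpow_natCast]
      congr 1
      push_cast [Nat.cast_sub hd]
      ring
    simp only [Function.comp_apply, h2, Complex.real_smul]
    obtain ⟨k, rfl⟩ := Nat.exists_eq_add_of_le' hd
    push_cast [Nat.add_sub_cancel]
    ring
  unfold besselJ
  rw [h1, ← mul_assoc, ← Complex.ofReal_mul]
  congr 2
  rw [← mul_div_assoc, ← Real.rpow_add hr, show ((d : ℝ) + 1) / 2 = d / 2 + 1 / 2 by ring]
  simp

theorem profile_eq {d : ℕ} (hd : 1 ≤ d) {x : ℝ} (hx : 0 ≤ x) :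
    profile d x = (Real.pi : ℂ)⁻¹ * ∫ r in Set.Ioi (2 * Real.pi * x), besselInt d r := by
  unfold profile
  rw [setIntegral_congr_fun measurableSet_Ioi
    (g := fun r => (((2 ^ ((d : ℝ) / 2) * Real.Gamma (((d : ℝ) + 1) / 2) * √Real.pi)⁻¹ : ℝ) : ℂ) *
        besselInt d r) (fun r hr => bessel_eq_besselInt d hd
          (lt_of_le_of_lt (by positivity) hr)), integral_const_mul, ← mul_assoc,
    ← Complex.ofReal_mul, ← Complex.ofReal_inv]
  congr 2
  have h1 : Real.Gamma (((d : ℝ) + 1) / 2) ≠ 0 := (Real.Gamma_pos_of_pos (by positivity)).ne'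
  have h2 : (2 : ℝ) ^ ((d : ℝ) / 2) ≠ 0 := (Real.rpow_pos_of_pos (by norm_num) _).ne'
  have h3 : √Real.pi ≠ 0 := (Real.sqrt_pos.mpr Real.pi_pos).ne'
  rw [div_mul_eq_mul_div, mul_inv, mul_inv]
  field_simp
  exact (Real.sq_sqrt Real.pi_pos.le).symm

theorem hasDerivAt_arctan_div (D r : ℝ) :
    HasDerivAt (fun r => 8 * Real.arctan (r / D)) ((8 / D) / (1 + (r / D) ^ 2)) r := by
  have := (((hasDerivAt_id r).div_const D).arctan).const_mul 8
  convert! this using 1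
  simp only [id]
  ring

theorem tendsto_arctan_div {D : ℝ} (hD : 0 < D) :
    Filter.Tendsto (fun r => 8 * Real.arctan (r / D)) Filter.atTop (nhds (8 * (Real.pi / 2))) :=
  (((Real.tendsto_arctan_atTop.mono_right nhdsWithin_le_nhds).comp
    (Filter.tendsto_id.atTop_div_const hD)).const_mul 8)

theorem integrableOn_cauchy {D : ℝ} (hD : 0 < D) (a : ℝ) :
    IntegrableOn (fun r => (8 / D) / (1 + (r / D) ^ 2)) (Set.Ioi a) :=
  integrableOn_Ioi_deriv_of_nonneg' (fun r _ => hasDerivAt_arctan_div D r)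
    (fun r _ => by positivity) (tendsto_arctan_div hD)

theorem integral_Ioi_cauchy {D : ℝ} (hD : 0 < D) (a : ℝ) :
    ∫ r in Set.Ioi a, (8 / D) / (1 + (r / D) ^ 2) =
      8 * (Real.pi / 2) - 8 * Real.arctan (a / D) :=
  integral_Ioi_of_hasDerivAt_of_nonneg' (fun r _ => hasDerivAt_arctan_div D r)
    (fun r _ => by positivity) (tendsto_arctan_div hD)

/-! ### Dimension-free bounds for the profile -/

variable {d : ℕ}

theorem integrableOn_besselInt (hd : 4 ≤ d) (a : ℝ) : IntegrableOn (besselInt d) (Set.Ioi a) :=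
  Integrable.mono' (integrableOn_cauchy (scale_pos hd) a)
    (continuous_besselInt d).aestronglyMeasurable
    (Filter.Eventually.of_forall fun r => norm_besselInt_le_div hd r)

theorem norm_profile_le_arctan (hd : 4 ≤ d) {x : ℝ} (hx : 0 ≤ x) :
    ‖profile d x‖ ≤
      Real.pi⁻¹ * (8 * (Real.pi / 2) - 8 * Real.arctan (2 * Real.pi * x / scale d)) := by
  rw [profile_eq (by omega) hx, norm_mul, norm_inv, Complex.norm_real,
    Real.norm_of_nonneg Real.pi_pos.le, ← integral_Ioi_cauchy (scale_pos hd)]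
  gcongr
  exact norm_integral_le_of_norm_le (integrableOn_cauchy (scale_pos hd) _)
    (Filter.Eventually.of_forall fun r => norm_besselInt_le_div hd r)

theorem norm_profile_zero_le (hd : 4 ≤ d) : ‖profile d 0‖ ≤ 4 := by
  refine (norm_profile_le_arctan hd le_rfl).trans (le_of_eq ?_)
  have := Real.pi_pos
  simp
  field_simp
  norm_num

/-- A continuously differentiable function on the line that agrees with the profile on `[0, ∞)`. -/
def profileExt (d : ℕ) (x : ℝ) : ℂ :=
  profile d 0 - (Real.pi : ℂ)⁻¹ * ∫ r in (0 : ℝ)..(2 * Real.pi * x), besselInt d r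

theorem profileExt_eq (hd : 4 ≤ d) {x : ℝ} (hx : 0 ≤ x) : profileExt d x = profile d x := by
  unfold profileExt
  rw [profile_eq (by omega) hx, profile_eq (by omega) le_rfl, mul_zero, ← mul_sub,
    intervalIntegral.integral_of_le (by positivity),
    ← Set.Ioc_union_Ioi_eq_Ioi (show (0 : ℝ) ≤ 2 * Real.pi * x by positivity),
    setIntegral_union (Set.Ioc_disjoint_Ioi le_rfl) measurableSet_Ioi
      ((integrableOn_besselInt hd 0).mono_set Set.Ioc_subset_Ioi_self)
      (integrableOn_besselInt hd _), add_sub_cancel_left]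

theorem hasDerivAt_profileExt (x : ℝ) :
    HasDerivAt (profileExt d) (-2 * besselInt d (2 * Real.pi * x)) x := by
  have h1 := (intervalIntegral.integral_hasDerivAt_right
    ((continuous_besselInt d).intervalIntegrable 0 (2 * Real.pi * x))
    (continuous_besselInt d).stronglyMeasurable.stronglyMeasurableAtFilter
    (continuous_besselInt d).continuousAt)
  have h2 : HasDerivAt (fun x : ℝ => 2 * Real.pi * x) (2 * Real.pi) x := by
    simpa using (hasDerivAt_id x).const_mul (2 * Real.pi)
  have h3 := ((h1.scomp x h2).const_mul (Real.pi : ℂ)⁻¹).const_sub (profile d 0)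
  convert! h3 using 1
  have := Complex.ofReal_ne_zero.mpr Real.pi_ne_zero
  rw [Complex.real_smul]
  push_cast
  field_simp

theorem norm_profile_sub_profile_zero_le (hd : 4 ≤ d) {x : ℝ} (hx : 0 ≤ x) :
    ‖profile d x - profile d 0‖ ≤
      Real.pi⁻¹ * (8 * Real.arctan (2 * Real.pi * x / scale d)) := by
  rw [← profileExt_eq hd hx, profileExt, sub_sub_cancel_left, norm_neg, norm_mul, norm_inv,
    Complex.norm_real, Real.norm_of_nonneg Real.pi_pos.le]
  have hc : Continuous fun r => (8 / scale d) / (1 + (r / scale d) ^ 2) :=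
    continuous_const.div (by fun_prop) fun r => by positivity
  have hx' : 0 ≤ 2 * Real.pi * x := by positivity
  have h := intervalIntegral.integral_eq_sub_of_hasDerivAt (a := 0) (b := 2 * Real.pi * x)
    (fun r _ => hasDerivAt_arctan_div (scale d) r) (hc.intervalIntegrable _ _)
  rw [zero_div, Real.arctan_zero, mul_zero, sub_zero] at h
  rw [← h]
  gcongr
  exact intervalIntegral.norm_integral_le_of_norm_le hx'
    (Filter.Eventually.of_forall fun r _ => norm_besselInt_le_div hd r)
    (hc.intervalIntegrable _ _)

/-! ### Subtracting a resolvent symbol from the profile -/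

theorem arctan_le_self {v : ℝ} (hv : 0 ≤ v) : Real.arctan v ≤ v := by
  simpa [Real.tan_arctan] using
    Real.le_tan (Real.arctan_nonneg.mpr hv) (Real.arctan_lt_pi_div_two v)

/-- The symbol of the resolvent `(1 - τΔ)⁻¹` at the natural scale, as a function of `|ξ|`. -/
def resolventSymbol (d : ℕ) (x : ℝ) : ℝ := 1 / (1 + (2 * Real.pi / scale d * x) ^ 2)

/-- The part of the profile that is controlled by a square function. -/
def diffSymbol (d : ℕ) (x : ℝ) : ℂ := profileExt d x - profile d 0 * (resolventSymbol d x : ℂ)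

/-- The derivative of `diffSymbol`. -/
def diffSymbolDeriv (d : ℕ) (x : ℝ) : ℂ :=
  -2 * besselInt d (2 * Real.pi * x) - profile d 0 *
    ((-(2 * (2 * Real.pi / scale d) ^ 2 * x) /
      (1 + (2 * Real.pi / scale d * x) ^ 2) ^ 2 : ℝ) : ℂ)

theorem hasDerivAt_diffSymbol (x : ℝ) :
    HasDerivAt (diffSymbol d) (diffSymbolDeriv d x) x := by
  refine (hasDerivAt_profileExt x).sub (HasDerivAt.const_mul _ (HasDerivAt.ofReal_comp ?_))
  set c := 2 * Real.pi / scale d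
  have h : HasDerivAt (fun x : ℝ => 1 + (c * x) ^ 2) (2 * c ^ 2 * x) x := by
    have := ((((hasDerivAt_id x).const_mul c).pow 2)).const_add 1
    convert! this using 1
    simp
    ring
  have h2 := h.inv (by positivity : 1 + (c * x) ^ 2 ≠ 0)
  unfold resolventSymbol
  simp only [one_div]
  exact h2

theorem continuous_diffSymbolDeriv : Continuous (diffSymbolDeriv d) := by
  have h1 : Continuous fun x : ℝ => (-(2 * (2 * Real.pi / scale d) ^ 2 * x) /
      (1 + (2 * Real.pi / scale d * x) ^ 2) ^ 2 : ℝ) :=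
    Continuous.div (by fun_prop) (by fun_prop) fun x => by positivity
  have := continuous_besselInt d
  unfold diffSymbolDeriv
  fun_prop

theorem diffSymbol_zero : diffSymbol d 0 = 0 := by
  simp [diffSymbol, profileExt, resolventSymbol]

/-- Put v = 2πx/D. For v ≤ 1 the profile and the resolvent term each differ from their common value
at 0 by at most 4v. For v ≥ 1 each is at most 4/v. The factor 1 + v² costs another 2 in either case.
-/
theorem norm_diffSymbol_le (hd : 4 ≤ d) {x : ℝ} (hx : 0 ≤ x) :
    ‖diffSymbol d x‖ ≤ 16 * ((2 * Real.pi / scale d * x) /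
      (1 + (2 * Real.pi / scale d * x) ^ 2)) := by
  have hD := scale_pos hd
  have hpi := Real.pi_pos
  have hpi3 := Real.pi_gt_three
  have hk := norm_profile_zero_le hd
  have ha := norm_profile_le_arctan hd hx
  have hb := norm_profile_sub_profile_zero_le hd hx
  rw [diffSymbol, profileExt_eq hd hx, resolventSymbol]
  rw [mul_div_right_comm] at ha hb
  set v := 2 * Real.pi / scale d * x
  have hv : 0 ≤ v := by positivity
  have hpi8 : Real.pi⁻¹ * 8 ≤ 4 := by
    rw [inv_mul_le_iff₀ hpi]; linarith
  rw [mul_div_assoc', le_div_iff₀ (by positivity)]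
  rcases le_total v 1 with h1 | h1
  · have e1 : ‖profile d x - profile d 0 * ((1 / (1 + v ^ 2) : ℝ) : ℂ)‖ ≤ 4 * v + 4 * v := by
      have : profile d x - profile d 0 * ((1 / (1 + v ^ 2) : ℝ) : ℂ) =
          (profile d x - profile d 0) + profile d 0 * ((1 - 1 / (1 + v ^ 2) : ℝ) : ℂ) := by
        push_cast; ring
      rw [this]
      refine (norm_add_le _ _).trans (add_le_add ?_ ?_)
      · refine hb.trans ?_
        rw [← mul_assoc]
        exact mul_le_mul hpi8 (arctan_le_self hv) (Real.arctan_nonneg.mpr hv) (by norm_num)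
      · have h2 : 1 - 1 / (1 + v ^ 2) = v ^ 2 / (1 + v ^ 2) := by field_simp; ring
        rw [norm_mul, Complex.norm_real, h2, Real.norm_of_nonneg (by positivity)]
        refine mul_le_mul hk ?_ (by positivity) (by norm_num)
        rw [div_le_iff₀ (by positivity)]
        nlinarith [mul_nonneg hv (sq_nonneg v)]
    nlinarith [mul_le_mul_of_nonneg_right e1 (by positivity : 0 ≤ 1 + v ^ 2),
      mul_nonneg hv (by nlinarith : 0 ≤ 1 - v ^ 2)]
  · have hv0 : 0 < v := by linarith
    have e1 : ‖profile d x - profile d 0 * ((1 / (1 + v ^ 2) : ℝ) : ℂ)‖ ≤ 4 * v⁻¹ + 4 * v⁻¹ := by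
      refine (norm_sub_le _ _).trans (add_le_add ?_ ?_)
      · refine ha.trans ?_
        -- The tail π/2 - arctan v equals arctan(1/v).
        rw [← mul_sub, ← mul_assoc, ← Real.arctan_inv_of_pos hv0]
        exact mul_le_mul hpi8 (arctan_le_self (by positivity))
          (Real.arctan_nonneg.mpr (by positivity)) (by norm_num)
      · rw [norm_mul, Complex.norm_real, Real.norm_of_nonneg (by positivity)]
        refine mul_le_mul hk ?_ (by positivity) (by norm_num)
        rw [one_div]
        exact inv_anti₀ hv0 (by nlinarith)
    have e2 : v⁻¹ * (1 + v ^ 2) ≤ 2 * v := by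
      rw [inv_mul_le_iff₀ hv0]
      nlinarith
    nlinarith [mul_le_mul_of_nonneg_right e1 (by positivity : 0 ≤ 1 + v ^ 2)]

/-- The Bessel term and the derivative of the resolvent symbol each contribute 8v/(1 + v²) with v =
2πx/D; the second uses 2v ≤ 1 + v². -/
theorem norm_mul_diffSymbolDeriv_le (hd : 4 ≤ d) {x : ℝ} (hx : 0 ≤ x) :
    x * ‖diffSymbolDeriv d x‖ ≤ 16 * ((2 * Real.pi / scale d * x) /
      (1 + (2 * Real.pi / scale d * x) ^ 2)) := by
  have hD := scale_pos hd
  have hpi3 := Real.pi_gt_three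
  have hk := norm_profile_zero_le hd
  have hb := norm_besselInt_le_div hd (2 * Real.pi * x)
  unfold diffSymbolDeriv
  rw [mul_div_right_comm] at hb
  set c := 2 * Real.pi / scale d
  have hc : 0 < c := by positivity
  have hv : 0 ≤ c * x := by positivity
  have e1 : x * ‖(-2 : ℂ) * besselInt d (2 * Real.pi * x)‖ ≤ 8 * (c * x / (1 + (c * x) ^ 2)) := by
    rw [norm_mul, norm_neg, Complex.norm_ofNat]
    have h8 : 8 / scale d ≤ 4 * c := by
      rw [show 4 * c = 8 * Real.pi / scale d by simp only [c]; ring]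
      gcongr
      linarith
    calc _ ≤ x * (2 * (4 * c / (1 + (c * x) ^ 2))) := by
          gcongr
          exact hb.trans (by gcongr)
      _ = _ := by ring
  have e2 : x * ‖profile d 0 * ((-(2 * c ^ 2 * x) / (1 + (c * x) ^ 2) ^ 2 : ℝ) : ℂ)‖ ≤
      8 * (c * x / (1 + (c * x) ^ 2)) := by
    rw [norm_mul, Complex.norm_real, norm_div, norm_neg, Real.norm_of_nonneg (by positivity),
      Real.norm_of_nonneg (by positivity)]
    have h3 : 2 * (c * x) / (1 + (c * x) ^ 2) ≤ 1 := by
      rw [div_le_one (by positivity)]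
      nlinarith [sq_nonneg (c * x - 1)]
    calc _ ≤ x * (4 * (2 * c ^ 2 * x / (1 + (c * x) ^ 2) ^ 2)) := by gcongr
      _ = (4 * (c * x / (1 + (c * x) ^ 2))) * (2 * (c * x) / (1 + (c * x) ^ 2)) := by
          field_simp
      _ ≤ (4 * (c * x / (1 + (c * x) ^ 2))) * 1 := by gcongr
      _ ≤ _ := by
          have : 0 ≤ c * x / (1 + (c * x) ^ 2) := by positivity
          linarith
  calc _ ≤ x * (‖(-2 : ℂ) * besselInt d (2 * Real.pi * x)‖ +
        ‖profile d 0 * ((-(2 * c ^ 2 * x) / (1 + (c * x) ^ 2) ^ 2 : ℝ) : ℂ)‖) := by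
        gcongr
        exact norm_sub_le _ _
    _ ≤ _ := by linarith

/-- Needed only to justify differentiation under the integral; the constant does not enter the final
estimate. -/
theorem exists_norm_diffSymbolDeriv_le (hd : 4 ≤ d) :
    ∃ C : ℝ, ∀ x, 0 ≤ x → ‖diffSymbolDeriv d x‖ ≤ C := by
  obtain ⟨C, hC⟩ := (isCompact_Icc (a := (0 : ℝ)) (b := 1)).exists_bound_of_continuousOn
    (f := diffSymbolDeriv d) continuous_diffSymbolDeriv.continuousOn
  refine ⟨max C 16, fun x hx => ?_⟩
  rcases le_total x 1 with h | h
  · exact (hC x ⟨hx, h⟩).trans (le_max_left _ _)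
  · have h1 := norm_mul_diffSymbolDeriv_le hd hx
    set v := 2 * Real.pi / scale d * x
    have h2 : v / (1 + v ^ 2) ≤ 1 := by
      rw [div_le_one (by positivity)]
      nlinarith [sq_nonneg (v - 1)]
    refine le_trans ?_ (le_max_right _ _)
    nlinarith [norm_nonneg (diffSymbolDeriv d x)]

/-! ### A maximal inequality for positive kernels -/

theorem sq_lintegral_mul_le {X : Type*} [MeasurableSpace X] (μ : Measure X) {f g : X → ℝ≥0∞}
    (hf : AEMeasurable f μ) (hg : AEMeasurable g μ) :
    (∫⁻ x, f x * g x ∂μ) ^ 2 ≤ (∫⁻ x, f x ^ 2 ∂μ) * ∫⁻ x, g x ^ 2 ∂μ := by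
  have h := ENNReal.lintegral_mul_le_Lp_mul_Lq μ Real.HolderConjugate.two_two hf hg
  simp only [ENNReal.rpow_two, Pi.mul_apply] at h
  refine (pow_le_pow_left' h 2).trans (le_of_eq ?_)
  rw [mul_pow]
  simp only [← ENNReal.rpow_two, ← ENNReal.rpow_mul]
  norm_num

section kernels

variable {X : Type*} [MeasurableSpace X] (μ : Measure X)

/-- The integral operator with kernel `K` on nonnegative functions. -/
def kernelOp (K : X → X → ℝ≥0∞) (f : X → ℝ≥0∞) (x : X) : ℝ≥0∞ := ∫⁻ y, K x y * f y ∂μ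

/-- The maximal function of the first `n` operators given by a sequence of kernels. -/
def kernelMax (K : ℕ → X → X → ℝ≥0∞) (n : ℕ) (f : X → ℝ≥0∞) (x : X) : ℝ≥0∞ :=
  (Finset.range n).sup fun i => kernelOp μ (K i) f x

/-- A sequence of symmetric sub-Markov kernels with `K i ∘ K j ≤ C K (i + 1)` for `j ≤ i`. -/
structure IsKernelChain (C : ℝ≥0∞) (K : ℕ → X → X → ℝ≥0∞) : Prop where
  measurable : ∀ i, Measurable (Function.uncurry (K i))
  symm : ∀ i x y, K i x y = K i y x
  mass : ∀ i x, ∫⁻ y, K i x y ∂μ ≤ 1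
  comp : ∀ i j, j ≤ i → ∀ x y, ∫⁻ z, K i x z * K j z y ∂μ ≤ C * K (i + 1) x y

variable {μ} {K : X → X → ℝ≥0∞} {f g : X → ℝ≥0∞}

variable [SFinite μ]

theorem measurable_kernelOp (hK : Measurable (Function.uncurry K)) (hf : Measurable f) :
    Measurable (kernelOp μ K f) :=
  Measurable.lintegral_prod_right' (f := fun p : X × X => K p.1 p.2 * f p.2)
    (hK.mul (hf.comp measurable_snd))

theorem lintegral_mul_kernelOp (hK : Measurable (Function.uncurry K))
    (hs : ∀ x y, K x y = K y x) (hf : Measurable f) (hg : Measurable g) :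
    ∫⁻ x, f x * kernelOp μ K g x ∂μ = ∫⁻ x, kernelOp μ K f x * g x ∂μ := by
  have hK1 (x) : Measurable (K x) := hK.of_uncurry_left
  have h1 (x) : f x * kernelOp μ K g x = ∫⁻ y, f x * (K x y * g y) ∂μ :=
    (lintegral_const_mul _ ((hK1 x).mul hg)).symm
  have h2 (y) : kernelOp μ K f y * g y = ∫⁻ x, f x * (K x y * g y) ∂μ := by
    rw [kernelOp, ← lintegral_mul_const _ (show Measurable fun x => K y x * f x from (hK1 y).mul hf)]
    refine lintegral_congr fun x => ?_
    rw [hs y x]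
    ring
  simp only [h1, h2]
  refine lintegral_lintegral_swap (Measurable.aemeasurable ?_)
  exact (hf.comp measurable_fst).mul (hK.mul (hg.comp measurable_snd))

theorem kernelOp_comp_le {K₁ K₂ K₃ : X → X → ℝ≥0∞} {C : ℝ≥0∞}
    (h₁ : Measurable (Function.uncurry K₁)) (h₂ : Measurable (Function.uncurry K₂))
    (h₃ : Measurable (Function.uncurry K₃)) (hf : Measurable f)
    (h : ∀ x y, ∫⁻ z, K₁ x z * K₂ z y ∂μ ≤ C * K₃ x y) (x : X) :
    kernelOp μ K₁ (kernelOp μ K₂ f) x ≤ C * kernelOp μ K₃ f x := by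
  have h1 (z) : K₁ x z * kernelOp μ K₂ f z = ∫⁻ y, K₁ x z * (K₂ z y * f y) ∂μ :=
    (lintegral_const_mul _ (h₂.of_uncurry_left.mul hf)).symm
  have h2 : kernelOp μ K₁ (kernelOp μ K₂ f) x =
      ∫⁻ y, (∫⁻ z, K₁ x z * K₂ z y ∂μ) * f y ∂μ := by
    rw [kernelOp]
    simp only [h1]
    rw [lintegral_lintegral_swap]
    · refine lintegral_congr fun y => ?_
      rw [← lintegral_mul_const _ (show Measurable fun z => K₁ x z * K₂ z y from
        h₁.of_uncurry_left.mul h₂.of_uncurry_right)]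
      refine lintegral_congr fun z => by ring
    · exact ((h₁.of_uncurry_left.comp measurable_fst).mul
        (h₂.mul (hf.comp measurable_snd))).aemeasurable
  rw [h2, kernelOp, ← lintegral_const_mul _ (show Measurable fun y => K₃ x y * f y from
    h₃.of_uncurry_left.mul hf)]
  refine lintegral_mono fun y => ?_
  rw [← mul_assoc]
  exact mul_le_mul_left (h x y) _

/-- Cauchy–Schwarz against the measure K(x, ·)μ, of mass at most 1, gives (Kf)² ≤ K(f²).
Integrating, symmetry moves K onto the constant 1. -/
theorem lintegral_kernelOp_sq_le (hK : Measurable (Function.uncurry K))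
    (hs : ∀ x y, K x y = K y x) (hm : ∀ x, ∫⁻ y, K x y ∂μ ≤ 1) (hf : Measurable f) :
    ∫⁻ x, kernelOp μ K f x ^ 2 ∂μ ≤ ∫⁻ x, f x ^ 2 ∂μ := by
  have hK1 (x) : Measurable (K x) := hK.of_uncurry_left
  have h1 (x) : kernelOp μ K f x ^ 2 ≤ kernelOp μ K (fun y => f y ^ 2) x := by
    have h := sq_lintegral_mul_le (μ.withDensity (K x)) (f := f) (g := 1)
      hf.aemeasurable aemeasurable_const
    simp only [Pi.one_apply, mul_one, one_pow] at h
    rw [lintegral_withDensity_eq_lintegral_mul _ (hK1 x) hf,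
      lintegral_withDensity_eq_lintegral_mul _ (hK1 x) (hf.pow_const 2),
      lintegral_one, withDensity_apply _ MeasurableSet.univ, setLIntegral_univ] at h
    exact h.trans (mul_le_of_le_one_right' (hm x))
  calc _ ≤ ∫⁻ x, 1 * kernelOp μ K (fun y => f y ^ 2) x ∂μ := by
        simpa using lintegral_mono h1
    _ = ∫⁻ x, kernelOp μ K 1 x * f x ^ 2 ∂μ :=
        lintegral_mul_kernelOp hK hs measurable_const (hf.pow_const 2)
    _ ≤ _ := lintegral_mono fun x => mul_le_of_le_one_left' (by simpa [kernelOp] using hm x)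

theorem measurable_kernelMax {K : ℕ → X → X → ℝ≥0∞}
    (hK : ∀ i, Measurable (Function.uncurry (K i))) (n : ℕ) (hf : Measurable f) :
    Measurable (kernelMax μ K n f) := by
  unfold kernelMax
  simp only [Finset.sup_eq_iSup]
  exact Measurable.iSup fun i => Measurable.iSup_Prop _ (measurable_kernelOp (hK i) hf)

omit [SFinite μ] in
theorem kernelOp_le_kernelMax {K : ℕ → X → X → ℝ≥0∞} {i n : ℕ} (h : i < n) (x : X) :
    kernelOp μ (K i) f x ≤ kernelMax μ K n f x :=
  Finset.le_sup (f := fun i => kernelOp μ (K i) f x) (Finset.mem_range.mpr h)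

/-- Measurable weights that select an index where the maximum is attained. -/
theorem exists_weights {u : ℕ → X → ℝ≥0∞} (hu : ∀ i, Measurable (u i)) (n : ℕ) :
    ∃ w : ℕ → X → ℝ≥0∞, (∀ i, Measurable (w i)) ∧
      (∀ x, ∑ i ∈ Finset.range (n + 1), w i x = 1) ∧
      ∀ x, ∑ i ∈ Finset.range (n + 1), w i x * u i x =
        (Finset.range (n + 1)).sup fun i => u i x := by
  induction n with
  | zero => exact ⟨fun _ _ => 1, fun _ => measurable_const, by simp, by simp⟩
  | succ n ih =>
    obtain ⟨w, hw, h1, h2⟩ := ih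
    set s : X → ℝ≥0∞ := fun x => (Finset.range (n + 1)).sup fun i => u i x
    have hs : Measurable s := by
      simp only [s, ← h2]
      exact Finset.measurable_fun_sum _ fun i _ => (hw i).mul (hu i)
    have hE : MeasurableSet {x | s x ≤ u (n + 1) x} := measurableSet_le hs (hu _)
    classical
    refine ⟨fun i => if i ≤ n then {x | s x ≤ u (n + 1) x}ᶜ.indicator (w i)
      else {x | s x ≤ u (n + 1) x}.indicator 1, fun i => ?_, fun x => ?_, fun x => ?_⟩
    · dsimp only
      split_ifs
      · exact (hw i).indicator hE.compl
      · exact measurable_one.indicator hE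
    · dsimp only
      rw [Finset.sum_range_succ, if_neg (by omega), ← h1 x]
      have : ∀ i ∈ Finset.range (n + 1), (if i ≤ n then {x | s x ≤ u (n + 1) x}ᶜ.indicator (w i)
          else {x | s x ≤ u (n + 1) x}.indicator 1) x =
            {x | s x ≤ u (n + 1) x}ᶜ.indicator (w i) x := fun i hi => by
        rw [if_pos (by simpa [Nat.lt_succ_iff] using hi)]
      rw [Finset.sum_congr rfl this]
      by_cases hx : s x ≤ u (n + 1) x
      · simp [hx, ← h1 x]
      · simp [hx]
    · dsimp only
      rw [Finset.sum_range_succ, if_neg (by omega), Finset.range_add_one (n := n + 1),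
        Finset.sup_insert]
      have : ∀ i ∈ Finset.range (n + 1), (if i ≤ n then {x | s x ≤ u (n + 1) x}ᶜ.indicator (w i)
          else {x | s x ≤ u (n + 1) x}.indicator 1) x * u i x =
            {x | s x ≤ u (n + 1) x}ᶜ.indicator (w i) x * u i x := fun i hi => by
        rw [if_pos (by simpa [Nat.lt_succ_iff] using hi)]
      rw [Finset.sum_congr rfl this]
      change _ = u (n + 1) x ⊔ s x
      by_cases hx : s x ≤ u (n + 1) x
      · simp [hx]
      · simp only [Set.mem_compl_iff, Set.mem_ofPred_eq, hx, not_false_eq_true,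
          Set.indicator_of_mem, Set.indicator_of_notMem, h2, zero_mul, add_zero]
        exact (sup_eq_right.mpr (not_le.mp hx).le).symm

end kernels

/-! ### Linearisation and bootstrapping of the maximal inequality -/

section kernels

variable {X : Type*} [MeasurableSpace X] {μ : Measure X} {K : ℕ → X → X → ℝ≥0∞} {C : ℝ≥0∞}
  {f g : X → ℝ≥0∞}

theorem sum_range_mul_sum_le (n : ℕ) (a : ℕ → ℕ → ℝ≥0∞) (ha : ∀ i j, a i j = a j i) :
    ∑ i ∈ Finset.range n, ∑ j ∈ Finset.range n, a i j ≤
      2 * ∑ i ∈ Finset.range n, ∑ j ∈ Finset.range (i + 1), a i j := by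
  induction n with
  | zero => simp
  | succ n ih =>
    rw [Finset.sum_range_succ (fun i => ∑ j ∈ Finset.range (i + 1), a i j) n,
      Finset.sum_range_succ (fun i => ∑ j ∈ Finset.range (n + 1), a i j) n]
    simp only [Finset.sum_range_succ (fun j => a _ j) n, Finset.sum_add_distrib]
    have : ∑ i ∈ Finset.range n, a i n = ∑ i ∈ Finset.range n, a n i :=
      Finset.sum_congr rfl fun i _ => ha i n
    rw [this, mul_add]
    calc _ = (∑ i ∈ Finset.range n, ∑ j ∈ Finset.range n, a i j) +
          (2 * ∑ i ∈ Finset.range n, a n i + a n n) := by ring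
      _ ≤ _ := by
        refine add_le_add ih ?_
        rw [mul_add]
        gcongr
        exact le_mul_of_one_le_left' (by norm_num)

theorem kernelOp_sum (hK : ∀ i, Measurable (Function.uncurry (K i))) (k n : ℕ)
    {F : ℕ → X → ℝ≥0∞} (hF : ∀ i, Measurable (F i)) (x : X) :
    ∑ j ∈ Finset.range n, kernelOp μ (K k) (F j) x =
      kernelOp μ (K k) (fun y => ∑ j ∈ Finset.range n, F j y) x := by
  unfold kernelOp
  rw [← lintegral_finsetSum _ fun j _ => show Measurable fun y => K k x y * F j y from
    (hK k).of_uncurry_left.mul (hF j)]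
  simp only [Finset.mul_sum]

variable [SFinite μ]

/-- Expand the square and keep the pairs j ≤ i at the cost of a factor 2. By symmetry such a term is
∫ F_i K_i K_j F_j ≤ C ∫ F_i K_{i+1} F_j. Summing over all j recovers K_{i+1} applied to the total
sum, and i + 1 may equal n, so the maximal function needs one more kernel. -/
theorem lintegral_sum_sq_le (h : IsKernelChain μ C K) (n : ℕ) {F : ℕ → X → ℝ≥0∞}
    (hF : ∀ i, Measurable (F i)) :
    ∫⁻ x, (∑ i ∈ Finset.range n, kernelOp μ (K i) (F i) x) ^ 2 ∂μ ≤
      2 * (C * ∫⁻ x, (∑ i ∈ Finset.range n, F i x) *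
        kernelMax μ K (n + 1) (fun x => ∑ i ∈ Finset.range n, F i x) x ∂μ) := by
  have hU (i j) : Measurable (kernelOp μ (K i) (F j)) := measurable_kernelOp (h.measurable i) (hF j)
  have hS : Measurable fun x => ∑ i ∈ Finset.range n, F i x :=
    Finset.measurable_fun_sum _ fun i _ => hF i
  set a : ℕ → ℕ → ℝ≥0∞ := fun i j =>
    ∫⁻ x, kernelOp μ (K i) (F i) x * kernelOp μ (K j) (F j) x ∂μ
  have e1 : ∫⁻ x, (∑ i ∈ Finset.range n, kernelOp μ (K i) (F i) x) ^ 2 ∂μ =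
      ∑ i ∈ Finset.range n, ∑ j ∈ Finset.range n, a i j := by
    simp only [sq, Finset.sum_mul_sum]
    rw [lintegral_finsetSum _ fun i _ => Finset.measurable_fun_sum _ fun j _ =>
      (hU i i).fun_mul (hU j j)]
    refine Finset.sum_congr rfl fun i _ => ?_
    rw [lintegral_finsetSum _ fun j _ => (hU i i).fun_mul (hU j j)]
  have e2 : ∀ i j, j ≤ i → a i j ≤
      C * ∫⁻ x, F i x * kernelOp μ (K (i + 1)) (F j) x ∂μ := fun i j hij => by
    change ∫⁻ x, _ ∂μ ≤ _
    rw [← lintegral_mul_kernelOp (h.measurable i) (h.symm i) (hF i) (hU j j),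
      ← lintegral_const_mul _ (show Measurable fun x => F i x * kernelOp μ (K (i + 1)) (F j) x from
        (hF i).mul (hU _ _))]
    refine lintegral_mono fun x => ?_
    calc _ ≤ F i x * (C * kernelOp μ (K (i + 1)) (F j) x) := mul_le_mul_right
          (kernelOp_comp_le (h.measurable i) (h.measurable j) (h.measurable (i + 1)) (hF j)
            (h.comp i j hij) x) _
      _ = _ := by ring
  rw [e1]
  refine (sum_range_mul_sum_le n a fun i j => ?_).trans ?_
  · exact lintegral_congr fun x => mul_comm _ _
  refine mul_le_mul_right ?_ _
  calc ∑ i ∈ Finset.range n, ∑ j ∈ Finset.range (i + 1), a i j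
      ≤ ∑ i ∈ Finset.range n, ∑ j ∈ Finset.range n,
          C * ∫⁻ x, F i x * kernelOp μ (K (i + 1)) (F j) x ∂μ := by
        refine Finset.sum_le_sum fun i hi => ?_
        have hin : i + 1 ≤ n := Finset.mem_range.mp hi
        exact (Finset.sum_le_sum fun j hj => e2 i j (by simpa [Nat.lt_succ_iff] using hj)).trans
          (Finset.sum_le_sum_of_subset (Finset.range_subset_range.mpr hin))
    _ = C * ∫⁻ x, ∑ i ∈ Finset.range n, F i x *
          kernelOp μ (K (i + 1)) (fun x => ∑ j ∈ Finset.range n, F j x) x ∂μ := by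
        simp only [← Finset.mul_sum]
        congr 1
        rw [lintegral_finsetSum _ fun i _ => show Measurable fun x => F i x *
          kernelOp μ (K (i + 1)) (fun x => ∑ j ∈ Finset.range n, F j x) x from
            (hF i).mul (measurable_kernelOp (h.measurable _) hS)]
        refine Finset.sum_congr rfl fun i _ => ?_
        rw [← lintegral_finsetSum _ fun j _ => show Measurable fun x => F i x *
          kernelOp μ (K (i + 1)) (F j) x from (hF i).mul (hU _ _)]
        simp only [← Finset.mul_sum, kernelOp_sum h.measurable _ n hF]
    _ ≤ _ := by
        refine mul_le_mul_right (lintegral_mono fun x => ?_) _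
        rw [Finset.sum_mul]
        refine Finset.sum_le_sum fun i hi => mul_le_mul_right ?_ _
        exact kernelOp_le_kernelMax (by simpa using hi) x

theorem lintegral_kernelMax_succ_sq_le (h : IsKernelChain μ C K) (n : ℕ) (hf : Measurable f) :
    ∫⁻ x, kernelMax μ K (n + 1) f x ^ 2 ∂μ ≤
      ∫⁻ x, kernelMax μ K n f x ^ 2 ∂μ + ∫⁻ x, f x ^ 2 ∂μ := by
  refine le_trans ?_ (add_le_add_right (lintegral_kernelOp_sq_le (h.measurable n) (h.symm n)
    (h.mass n) hf) _)
  rw [← lintegral_add_left ((measurable_kernelMax h.measurable n hf).pow_const 2)]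
  refine lintegral_mono fun x => ?_
  have : kernelMax μ K (n + 1) f x = kernelOp μ (K n) f x ⊔ kernelMax μ K n f x := by
    rw [kernelMax, Finset.range_add_one, Finset.sup_insert, kernelMax]
  rw [this]
  rcases le_total (kernelOp μ (K n) f x) (kernelMax μ K n f x) with h1 | h1
  · rw [sup_eq_right.mpr h1]
    exact le_self_add
  · rw [sup_eq_left.mpr h1]
    exact le_add_self

/-- Crude a priori bound: it provides the finiteness needed for division and the starting point of
the iteration. -/
theorem lintegral_kernelMax_sq_le_nat (h : IsKernelChain μ C K) (n : ℕ) (hf : Measurable f) :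
    ∫⁻ x, kernelMax μ K n f x ^ 2 ∂μ ≤ n * ∫⁻ x, f x ^ 2 ∂μ := by
  induction n with
  | zero => simp [kernelMax]
  | succ n ih =>
    refine (lintegral_kernelMax_succ_sq_le h n hf).trans ?_
    push_cast
    rw [add_mul, one_mul]
    gcongr

theorem eight_mul_le (a b : ℝ≥0∞) : 8 * (a * b) ≤ 32 * a ^ 2 + 2⁻¹ * b ^ 2 := by
  rcases eq_or_ne a ∞ with rfl | ha
  · simp [ENNReal.mul_top]
  rcases eq_or_ne b ∞ with rfl | hb
  · simp [ENNReal.mul_top]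
  lift a to NNReal using ha
  lift b to NNReal using hb
  rw [show (2⁻¹ : ℝ≥0∞) = ((2⁻¹ : NNReal) : ℝ≥0∞) by simp]
  norm_cast
  rw [← NNReal.coe_le_coe]
  push_cast
  nlinarith [sq_nonneg (8 * (a : ℝ) - b)]

/-- With weights w_i selecting a maximising index, the maximal function F satisfies ∫F² = ∫ fG,
where G = Σ K_i(w_i F). Since the w_i F sum to F, ∫G² is at most 8∫ F · MF, with M the maximal
operator with one more kernel. Splitting this product by the weighted AM–GM inequality brings in N +
1, the extra 1 paying for the additional kernel. Cauchy–Schwarz and division by ∫F² finish. -/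
theorem lintegral_kernelMax_sq_improve (h : IsKernelChain μ 4 K) (n : ℕ) (N : ℝ≥0∞)
    (hN : ∀ f : X → ℝ≥0∞, Measurable f →
      ∫⁻ x, kernelMax μ K (n + 1) f x ^ 2 ∂μ ≤ N * ∫⁻ x, f x ^ 2 ∂μ)
    (hf : Measurable f) :
    ∫⁻ x, kernelMax μ K (n + 1) f x ^ 2 ∂μ ≤ (32 + 2⁻¹ * (N + 1)) * ∫⁻ x, f x ^ 2 ∂μ := by
  rcases eq_or_ne (∫⁻ x, f x ^ 2 ∂μ) ∞ with htop | htop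
  · rw [htop, ENNReal.mul_top (by simp)]
    exact le_top
  set F := kernelMax μ K (n + 1) f
  have hF : Measurable F := measurable_kernelMax h.measurable _ hf
  obtain ⟨w, hw, h1, h2⟩ := exists_weights (u := fun i => kernelOp μ (K i) f)
    (fun i => measurable_kernelOp (h.measurable i) hf) n
  have hwF (i) : Measurable fun x => w i x * F x := (hw i).mul hF
  have hsum : (fun x => ∑ i ∈ Finset.range (n + 1), w i x * F x) = F := by
    ext x
    rw [← Finset.sum_mul, h1, one_mul]
  set G : X → ℝ≥0∞ := fun x => ∑ i ∈ Finset.range (n + 1), kernelOp μ (K i) (fun x => w i x * F x) x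
  have hG : Measurable G := Finset.measurable_fun_sum _ fun i _ =>
    measurable_kernelOp (h.measurable i) (hwF i)
  have hGsq : ∫⁻ x, G x ^ 2 ∂μ ≤ (32 + 2⁻¹ * (N + 1)) * ∫⁻ x, F x ^ 2 ∂μ := by
    have h3 := lintegral_sum_sq_le h (n + 1) hwF
    have hsum' (x) : ∑ i ∈ Finset.range (n + 1), w i x * F x = F x := congrFun hsum x
    simp only [hsum'] at h3
    have hM := measurable_kernelMax (μ := μ) h.measurable (n + 1 + 1) hF
    refine h3.trans ?_
    rw [← mul_assoc, ← lintegral_const_mul _ (show Measurable fun x => F x *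
      kernelMax μ K (n + 1 + 1) F x from hF.mul hM)]
    calc _ ≤ ∫⁻ x, 32 * F x ^ 2 + 2⁻¹ * kernelMax μ K (n + 1 + 1) F x ^ 2 ∂μ := by
          refine lintegral_mono fun x => ?_
          norm_num
          exact eight_mul_le _ _
      _ = 32 * ∫⁻ x, F x ^ 2 ∂μ + 2⁻¹ * ∫⁻ x, kernelMax μ K (n + 1 + 1) F x ^ 2 ∂μ := by
          rw [lintegral_add_left ((hF.pow_const 2).const_mul _),
            lintegral_const_mul _ (hF.pow_const 2), lintegral_const_mul _ (hM.pow_const 2)]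
      _ ≤ 32 * ∫⁻ x, F x ^ 2 ∂μ + 2⁻¹ * (N * ∫⁻ x, F x ^ 2 ∂μ + ∫⁻ x, F x ^ 2 ∂μ) := by
          gcongr
          exact (lintegral_kernelMax_succ_sq_le h _ hF).trans (by gcongr; exact hN F hF)
      _ = _ := by ring
  have hFG : ∫⁻ x, F x ^ 2 ∂μ = ∫⁻ x, f x * G x ∂μ := by
    calc ∫⁻ x, F x ^ 2 ∂μ
        = ∫⁻ x, ∑ i ∈ Finset.range (n + 1), (w i x * F x) * kernelOp μ (K i) f x ∂μ := by
          refine lintegral_congr fun x => ?_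
          rw [sq]
          nth_rw 1 [show F x = ∑ i ∈ Finset.range (n + 1), w i x * kernelOp μ (K i) f x from
            (h2 x).symm]
          rw [Finset.sum_mul]
          exact Finset.sum_congr rfl fun i _ => by ring
      _ = ∑ i ∈ Finset.range (n + 1), ∫⁻ x, f x * kernelOp μ (K i) (fun x => w i x * F x) x ∂μ := by
          rw [lintegral_finsetSum _ fun i _ => (hwF i).fun_mul (measurable_kernelOp (h.measurable i) hf)]
          refine Finset.sum_congr rfl fun i _ => ?_
          rw [lintegral_mul_kernelOp (h.measurable i) (h.symm i) (hwF i) hf]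
          exact lintegral_congr fun x => mul_comm _ _
      _ = _ := by
          rw [← lintegral_finsetSum _ fun i _ => hf.fun_mul
            (measurable_kernelOp (h.measurable i) (hwF i))]
          simp only [G, Finset.mul_sum]
  have hfin : ∫⁻ x, F x ^ 2 ∂μ ≠ ∞ := ne_top_of_le_ne_top
    (ENNReal.mul_ne_top (ENNReal.natCast_ne_top _) htop) (lintegral_kernelMax_sq_le_nat h _ hf)
  rcases eq_or_ne (∫⁻ x, F x ^ 2 ∂μ) 0 with h0 | h0
  · rw [h0]
    exact zero_le
  have h4 : (∫⁻ x, F x ^ 2 ∂μ) * ∫⁻ x, F x ^ 2 ∂μ ≤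
      ((32 + 2⁻¹ * (N + 1)) * ∫⁻ x, f x ^ 2 ∂μ) * ∫⁻ x, F x ^ 2 ∂μ := by
    calc _ = (∫⁻ x, f x * G x ∂μ) ^ 2 := by rw [← hFG, sq]
      _ ≤ (∫⁻ x, f x ^ 2 ∂μ) * ∫⁻ x, G x ^ 2 ∂μ :=
          sq_lintegral_mul_le μ hf.aemeasurable hG.aemeasurable
      _ ≤ (∫⁻ x, f x ^ 2 ∂μ) * ((32 + 2⁻¹ * (N + 1)) * ∫⁻ x, F x ^ 2 ∂μ) := by gcongr
      _ = _ := by ring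
  exact (ENNReal.mul_le_mul_iff_left h0 hfin).mp h4

/-- The maximal inequality for a chain of kernels. -/
theorem lintegral_kernelMax_sq_le (h : IsKernelChain μ 4 K) (n : ℕ) (hf : Measurable f) :
    ∫⁻ x, kernelMax μ K n f x ^ 2 ∂μ ≤ 66 * ∫⁻ x, f x ^ 2 ∂μ := by
  rcases n with _ | n
  · simp [kernelMax]
  -- The map N ↦ 32 + (N + 1)/2 has fixed point 65 and halves the distance to it, so iterating from
  -- the crude bound removes the dependence on n. Stopping once 2^k ≥ n + 1 leaves an excess of at
  -- most 1.
  have key : ∀ k : ℕ, ∀ f : X → ℝ≥0∞, Measurable f → ∫⁻ x, kernelMax μ K (n + 1) f x ^ 2 ∂μ ≤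
      (65 + 2⁻¹ ^ k * (n + 1)) * ∫⁻ x, f x ^ 2 ∂μ := fun k => by
    induction k with
    | zero =>
      intro f hf
      refine (lintegral_kernelMax_sq_le_nat h _ hf).trans ?_
      rw [pow_zero, one_mul, Nat.cast_succ]
      exact mul_le_mul_left le_add_self _
    | succ k ih =>
      intro f hf
      refine (lintegral_kernelMax_sq_improve h n _ ih hf).trans (le_of_eq ?_)
      congr 1
      have h2 : (2 : ℝ≥0∞)⁻¹ * 2 = 1 := ENNReal.inv_mul_cancel (by norm_num) (by norm_num)
      calc (32 : ℝ≥0∞) + 2⁻¹ * (65 + 2⁻¹ ^ k * (n + 1) + 1)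
          = 32 + 33 * (2⁻¹ * 2) + 2⁻¹ ^ (k + 1) * (n + 1) := by ring
        _ = _ := by rw [h2]; norm_num
  obtain ⟨k, hk⟩ : ∃ k : ℕ, (n + 1 : ℝ≥0∞) ≤ 2 ^ k :=
    ⟨n + 1, by exact_mod_cast (Nat.lt_two_pow_self (n := n + 1)).le⟩
  refine (key k f hf).trans ?_
  gcongr
  calc (65 : ℝ≥0∞) + 2⁻¹ ^ k * (n + 1) ≤ 65 + 2⁻¹ ^ k * 2 ^ k := by gcongr
    _ = 66 := by
      rw [← mul_pow, ENNReal.inv_mul_cancel (by norm_num) (by norm_num), one_pow]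
      norm_num

end kernels

/-! ### Gaussian and resolvent kernels -/

/-- The Gaussian kernel with symbol `e^{-β|ξ|²}`. -/
def heatKernel (d : ℕ) (β : ℝ) (z : EuclideanSpace ℝ (Fin d)) : ℝ :=
  (Real.pi / β) ^ ((d : ℝ) / 2) * Real.exp (-(Real.pi ^ 2 / β) * ‖z‖ ^ 2)

theorem heatKernel_nonneg {β : ℝ} (hβ : 0 ≤ β) (z : EuclideanSpace ℝ (Fin d)) :
    0 ≤ heatKernel d β z := by
  unfold heatKernel
  have := Real.pi_pos
  positivity

theorem integral_heatKernel {β : ℝ} (hβ : 0 < β) :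
    ∫ z : EuclideanSpace ℝ (Fin d), heatKernel d β z = 1 := by
  unfold heatKernel
  have hpi := Real.pi_pos
  rw [integral_const_mul, GaussianFourier.integral_rexp_neg_mul_sq_norm (by positivity),
    finrank_euclideanSpace_fin, ← Real.mul_rpow (by positivity) (by positivity)]
  rw [show Real.pi / β * (Real.pi / (Real.pi ^ 2 / β)) = 1 by field_simp, Real.one_rpow]

theorem lintegral_heatKernel {β : ℝ} (hβ : 0 < β) :
    ∫⁻ z : EuclideanSpace ℝ (Fin d), ENNReal.ofReal (heatKernel d β z) = 1 := by
  rw [← ofReal_integral_eq_lintegral_ofReal _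
    (Filter.Eventually.of_forall fun z => heatKernel_nonneg hβ.le z), integral_heatKernel hβ,
    ENNReal.ofReal_one]
  exact Integrable.of_integral_ne_zero (by rw [integral_heatKernel hβ]; norm_num)

/-- Completing the square in z. Integrated over z, this is the semigroup law. -/
theorem heatKernel_mul_heatKernel {β γ : ℝ} (hβ : 0 < β) (hγ : 0 < γ)
    (x y z : EuclideanSpace ℝ (Fin d)) :
    heatKernel d β (x - z) * heatKernel d γ (z - y) =
      heatKernel d (β * γ / (β + γ)) (z - (y + (γ / (β + γ)) • (x - y))) *
        heatKernel d (β + γ) (x - y) := by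
  unfold heatKernel
  have hpi := Real.pi_pos
  rw [mul_mul_mul_comm, mul_mul_mul_comm ((Real.pi / (β * γ / (β + γ))) ^ ((d : ℝ) / 2)),
    ← Real.mul_rpow (by positivity) (by positivity),
    ← Real.mul_rpow (by positivity) (by positivity), ← Real.exp_add, ← Real.exp_add]
  congr 2
  · field_simp
  · rw [show x - z = (x - y) - (z - y) by abel,
      show z - (y + (γ / (β + γ)) • (x - y)) = (z - y) - (γ / (β + γ)) • (x - y) by abel]
    generalize x - y = h
    generalize z - y = u
    rw [norm_sub_sq_real, norm_sub_sq_real, inner_smul_right, norm_smul, real_inner_comm,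
      Real.norm_of_nonneg (by positivity)]
    field_simp
    ring

theorem lintegral_heatKernel_mul_heatKernel {β γ : ℝ} (hβ : 0 < β) (hγ : 0 < γ)
    (x y : EuclideanSpace ℝ (Fin d)) :
    ∫⁻ z, ENNReal.ofReal (heatKernel d β (x - z)) * ENNReal.ofReal (heatKernel d γ (z - y)) =
      ENNReal.ofReal (heatKernel d (β + γ) (x - y)) := by
  have hδ : 0 < β * γ / (β + γ) := by positivity
  simp only [← ENNReal.ofReal_mul (heatKernel_nonneg hβ.le _), heatKernel_mul_heatKernel hβ hγ,
    ENNReal.ofReal_mul (heatKernel_nonneg hδ.le _)]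
  rw [lintegral_mul_const'' _ (by unfold heatKernel; fun_prop),
    lintegral_sub_right_eq_self (fun z => ENNReal.ofReal (heatKernel d (β * γ / (β + γ)) z)),
    lintegral_heatKernel hδ, one_mul]

/-- The exponential density on `(0, ∞)` with mean `τ`. -/
def expDensity (τ s : ℝ) : ℝ := Real.exp (-s / τ) / τ

theorem expDensity_nonneg {τ : ℝ} (hτ : 0 < τ) (s : ℝ) : 0 ≤ expDensity τ s := by
  unfold expDensity
  positivity

theorem hasDerivAt_exp_neg_div {τ : ℝ} (s : ℝ) :
    HasDerivAt (fun s => -Real.exp (-s / τ)) (expDensity τ s) s := by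
  have := (((hasDerivAt_neg s).div_const τ).exp).neg
  convert! this using 1
  unfold expDensity
  ring

theorem tendsto_exp_neg_div {τ : ℝ} (hτ : 0 < τ) :
    Filter.Tendsto (fun s => -Real.exp (-s / τ)) Filter.atTop (nhds 0) := by
  rw [← neg_zero]
  refine (Real.tendsto_exp_atBot.comp ?_).neg
  exact Filter.tendsto_neg_atTop_atBot.atBot_div_const hτ

theorem integrableOn_expDensity {τ : ℝ} (hτ : 0 < τ) :
    IntegrableOn (expDensity τ) (Set.Ioi 0) :=
  integrableOn_Ioi_deriv_of_nonneg' (fun s _ => hasDerivAt_exp_neg_div s)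
    (fun s _ => expDensity_nonneg hτ s) (tendsto_exp_neg_div hτ)

theorem integral_expDensity {τ : ℝ} (hτ : 0 < τ) :
    ∫ s in Set.Ioi 0, expDensity τ s = 1 := by
  rw [integral_Ioi_of_hasDerivAt_of_nonneg' (fun s _ => hasDerivAt_exp_neg_div s)
    (fun s _ => expDensity_nonneg hτ s) (tendsto_exp_neg_div hτ)]
  simp

theorem lintegral_expDensity {τ : ℝ} (hτ : 0 < τ) :
    ∫⁻ s in Set.Ioi 0, ENNReal.ofReal (expDensity τ s) = 1 := by
  rw [← ofReal_integral_eq_lintegral_ofReal (integrableOn_expDensity hτ)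
    (Filter.Eventually.of_forall fun s => expDensity_nonneg hτ s), integral_expDensity hτ,
    ENNReal.ofReal_one]

theorem measurable_expDensity (τ : ℝ) : Measurable (expDensity τ) := by
  unfold expDensity
  fun_prop

/-- Since s'/τ ≤ s'/ρ, half of the total decay already controls (s + s')/(2τ) + s'/(2ρ). The 4 is
the ratio of the normalisations 2τ · 2ρ and τρ. -/
theorem expDensity_mul_le {τ ρ s s' : ℝ} (hτ : 0 < τ) (hρ : 0 < ρ) (h : ρ ≤ τ) (hs : 0 ≤ s)
    (hs' : 0 ≤ s') : expDensity τ s * expDensity ρ s' ≤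
      4 * (expDensity (2 * τ) (s + s') * expDensity (2 * ρ) s') := by
  unfold expDensity
  have h1 : -s / τ + -s' / ρ ≤ -(s + s') / (2 * τ) + -s' / (2 * ρ) := by
    have h2 : s' / τ ≤ s' / ρ := div_le_div_of_nonneg_left hs' hρ h
    have h3 : 0 ≤ s / τ := by positivity
    have e1 : -(s + s') / (2 * τ) = -(s / τ) / 2 - (s' / τ) / 2 := by field_simp; ring
    have e2 : -s' / (2 * ρ) = -(s' / ρ) / 2 := by field_simp
    rw [e1, e2, neg_div, neg_div]
    linarith
  rw [div_mul_div_comm, div_mul_div_comm, ← Real.exp_add, ← Real.exp_add, mul_div_assoc',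
    div_le_div_iff₀ (by positivity) (by positivity)]
  have := Real.exp_le_exp.mpr h1
  calc _ ≤ Real.exp (-(s + s') / (2 * τ) + -s' / (2 * ρ)) * (2 * τ * (2 * ρ)) := by gcongr
    _ = _ := by ring

theorem expDensity_le {τ σ s : ℝ} (hτ : 0 < τ) (h : τ ≤ σ) (h2 : σ ≤ 2 * τ) (hs : 0 ≤ s) :
    expDensity τ s ≤ 2 * expDensity σ s := by
  unfold expDensity
  have hσ : 0 < σ := hτ.trans_le h
  have h1 : Real.exp (-s / τ) ≤ Real.exp (-s / σ) := by
    rw [Real.exp_le_exp, neg_div, neg_div]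
    exact neg_le_neg (div_le_div_of_nonneg_left hs hτ h)
  rw [mul_div_assoc', div_le_div_iff₀ hτ hσ]
  nlinarith [Real.exp_pos (-s / σ), Real.exp_pos (-s / τ)]

/-- The kernel of the resolvent with symbol `1 / (1 + τ|ξ|²)`. -/
def resolventKernel (d : ℕ) (τ : ℝ) (x y : EuclideanSpace ℝ (Fin d)) : ℝ≥0∞ :=
  ∫⁻ s in Set.Ioi 0, ENNReal.ofReal (expDensity τ s) * ENNReal.ofReal (heatKernel d s (x - y))

theorem measurable_expDensity_mul_heatKernel (τ : ℝ) :
    Measurable fun p : (EuclideanSpace ℝ (Fin d) × EuclideanSpace ℝ (Fin d)) × ℝ =>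
      ENNReal.ofReal (expDensity τ p.2) * ENNReal.ofReal (heatKernel d p.2 (p.1.1 - p.1.2)) := by
  unfold heatKernel expDensity
  fun_prop

theorem measurable_resolventKernel (τ : ℝ) :
    Measurable (Function.uncurry (resolventKernel d τ)) :=
  (measurable_expDensity_mul_heatKernel τ).lintegral_prod_right'
    (ν := volume.restrict (Set.Ioi (0 : ℝ)))

theorem resolventKernel_symm (τ : ℝ) (x y : EuclideanSpace ℝ (Fin d)) :
    resolventKernel d τ x y = resolventKernel d τ y x := by
  simp only [resolventKernel, heatKernel, norm_sub_rev x y]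

theorem lintegral_resolventKernel {τ : ℝ} (hτ : 0 < τ) (x : EuclideanSpace ℝ (Fin d)) :
    ∫⁻ y, resolventKernel d τ x y = 1 := by
  unfold resolventKernel
  rw [lintegral_lintegral_swap]
  · rw [← lintegral_expDensity hτ]
    refine setLIntegral_congr_fun measurableSet_Ioi fun s hs => ?_
    rw [lintegral_const_mul' _ _ ENNReal.ofReal_ne_top,
      lintegral_sub_left_eq_self (fun z => ENNReal.ofReal (heatKernel d s z)),
      lintegral_heatKernel hs, mul_one]
  · exact ((measurable_expDensity_mul_heatKernel τ).comp
      (f := fun p : EuclideanSpace ℝ (Fin d) × ℝ => ((x, p.1), p.2)) (by fun_prop)).aemeasurable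

theorem setLIntegral_Ioi_add_le (F : ℝ → ℝ≥0∞) {a : ℝ} (ha : 0 ≤ a) :
    ∫⁻ s in Set.Ioi 0, F (s + a) ≤ ∫⁻ s in Set.Ioi 0, F s := by
  rw [← lintegral_indicator measurableSet_Ioi, ← lintegral_indicator measurableSet_Ioi,
    ← lintegral_add_right_eq_self ((Set.Ioi (0 : ℝ)).indicator F) a]
  refine lintegral_mono fun s => ?_
  by_cases hs : s ∈ Set.Ioi (0 : ℝ)
  · have : s + a ∈ Set.Ioi (0 : ℝ) := add_pos_of_pos_of_nonneg hs ha
    rw [Set.indicator_of_mem hs, Set.indicator_of_mem this]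
  · rw [Set.indicator_of_notMem hs]
    exact zero_le

/-- Composing heat kernels at times s and s' gives time s + s'. By `expDensity_mul_le` the joint
density is at most 4 times a density in s + s' with mean 2τ times one in s' alone. Shifting s by s'
bounds the s-integral by the kernel at 2τ, and the remaining density in s' has mass 1. -/
theorem lintegral_resolventKernel_mul_le {τ ρ : ℝ} (hτ : 0 < τ) (hρ : 0 < ρ) (h : ρ ≤ τ)
    (x y : EuclideanSpace ℝ (Fin d)) :
    ∫⁻ z, resolventKernel d τ x z * resolventKernel d ρ z y ≤
      4 * resolventKernel d (2 * τ) x y := by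
  set A : ℝ → EuclideanSpace ℝ (Fin d) → ℝ≥0∞ := fun s z =>
    ENNReal.ofReal (expDensity τ s) * ENNReal.ofReal (heatKernel d s (x - z))
  set B : ℝ → EuclideanSpace ℝ (Fin d) → ℝ≥0∞ := fun s z =>
    ENNReal.ofReal (expDensity ρ s) * ENNReal.ofReal (heatKernel d s (z - y))
  have hA : Measurable fun p : ℝ × EuclideanSpace ℝ (Fin d) => A p.1 p.2 :=
    (measurable_expDensity_mul_heatKernel τ).comp
      (f := fun p : ℝ × EuclideanSpace ℝ (Fin d) => ((x, p.2), p.1)) (by fun_prop)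
  have hB : Measurable fun p : ℝ × EuclideanSpace ℝ (Fin d) => B p.1 p.2 :=
    (measurable_expDensity_mul_heatKernel ρ).comp
      (f := fun p : ℝ × EuclideanSpace ℝ (Fin d) => ((p.2, y), p.1)) (by fun_prop)
  have hA1 (z) : Measurable fun s => A s z := hA.of_uncurry_right
  have hB1 (z) : Measurable fun s => B s z := hB.of_uncurry_right
  have e1 : ∫⁻ z, resolventKernel d τ x z * resolventKernel d ρ z y =
      ∫⁻ s' in Set.Ioi 0, ∫⁻ s in Set.Ioi 0, ∫⁻ z, A s z * B s' z := by
    have e2 (z) : resolventKernel d τ x z * resolventKernel d ρ z y =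
        ∫⁻ s' in Set.Ioi 0, ∫⁻ s in Set.Ioi 0, A s z * B s' z := by
      change (∫⁻ s in Set.Ioi 0, A s z) * (∫⁻ s' in Set.Ioi 0, B s' z) = _
      rw [← lintegral_const_mul _ (hB1 z)]
      refine lintegral_congr fun s' => ?_
      rw [lintegral_mul_const _ (hA1 z)]
    simp only [e2]
    have hABm : Measurable fun p : (EuclideanSpace ℝ (Fin d) × ℝ) × ℝ =>
        A p.2 p.1.1 * B p.1.2 p.1.1 :=
      (hA.comp (f := fun p : (EuclideanSpace ℝ (Fin d) × ℝ) × ℝ => (p.2, p.1.1))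
        (by fun_prop)).fun_mul
      (hB.comp (f := fun p : (EuclideanSpace ℝ (Fin d) × ℝ) × ℝ => (p.1.2, p.1.1)) (by fun_prop))
    rw [lintegral_lintegral_swap]
    · refine lintegral_congr fun s' => ?_
      rw [lintegral_lintegral_swap]
      exact (hABm.comp (f := fun p : EuclideanSpace ℝ (Fin d) × ℝ => ((p.1, s'), p.2))
        (by fun_prop)).aemeasurable
    · exact (hABm.lintegral_prod_right' (ν := volume.restrict (Set.Ioi (0 : ℝ)))).aemeasurable
  have e3 : ∀ s' ∈ Set.Ioi (0 : ℝ), ∫⁻ s in Set.Ioi 0, ∫⁻ z, A s z * B s' z ≤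
      ENNReal.ofReal (expDensity (2 * ρ) s') * (4 * resolventKernel d (2 * τ) x y) := by
    intro s' hs'
    calc ∫⁻ s in Set.Ioi 0, ∫⁻ z, A s z * B s' z
        ≤ ∫⁻ s in Set.Ioi 0, (ENNReal.ofReal (expDensity (2 * ρ) s') * 4) *
            (ENNReal.ofReal (expDensity (2 * τ) (s + s')) *
              ENNReal.ofReal (heatKernel d (s + s') (x - y))) := by
          refine setLIntegral_mono' measurableSet_Ioi fun s hs => ?_
          have e4 (z) : A s z * B s' z = ENNReal.ofReal (expDensity τ s * expDensity ρ s') *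
              (ENNReal.ofReal (heatKernel d s (x - z)) *
                ENNReal.ofReal (heatKernel d s' (z - y))) := by
            rw [ENNReal.ofReal_mul (expDensity_nonneg hτ s)]
            ring
          simp only [e4]
          rw [lintegral_const_mul' _ _ ENNReal.ofReal_ne_top,
            lintegral_heatKernel_mul_heatKernel hs hs', ← mul_assoc]
          refine mul_le_mul_left ?_ _
          refine (ENNReal.ofReal_le_ofReal (expDensity_mul_le hτ hρ h (le_of_lt hs)
            (le_of_lt hs'))).trans (le_of_eq ?_)
          rw [ENNReal.ofReal_mul (by norm_num),
            ENNReal.ofReal_mul (expDensity_nonneg (by positivity) _)]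
          norm_num
          ring
      _ = (ENNReal.ofReal (expDensity (2 * ρ) s') * 4) * ∫⁻ s in Set.Ioi 0,
            (ENNReal.ofReal (expDensity (2 * τ) (s + s')) *
              ENNReal.ofReal (heatKernel d (s + s') (x - y))) :=
          lintegral_const_mul' _ _ (ENNReal.mul_ne_top ENNReal.ofReal_ne_top (by norm_num))
      _ ≤ _ := by
          rw [mul_assoc]
          gcongr
          exact setLIntegral_Ioi_add_le (fun s => ENNReal.ofReal (expDensity (2 * τ) s) *
              ENNReal.ofReal (heatKernel d s (x - y))) (le_of_lt hs')
  rw [e1]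
  refine (setLIntegral_mono' measurableSet_Ioi e3).trans ?_
  rw [lintegral_mul_const _ (measurable_expDensity _).ennreal_ofReal,
    lintegral_expDensity (by positivity), one_mul]

theorem isKernelChain_resolventKernel {τ : ℝ} (hτ : 0 < τ) :
    IsKernelChain (volume : Measure (EuclideanSpace ℝ (Fin d))) 4
      fun i => resolventKernel d (2 ^ i * τ) where
  measurable i := measurable_resolventKernel _
  symm i := resolventKernel_symm _
  mass i x := (lintegral_resolventKernel (by positivity) x).le
  comp i j hij x y := by
    rw [pow_succ', mul_assoc]
    refine lintegral_resolventKernel_mul_le (by positivity) (by positivity) ?_ x y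
    gcongr
    norm_num

/-- The maximal function of the resolvents along dyadic parameters. -/
def resolventMax (d : ℕ) (f : EuclideanSpace ℝ (Fin d) → ℝ≥0∞) (x : EuclideanSpace ℝ (Fin d)) :
    ℝ≥0∞ :=
  ⨆ n : ℕ, kernelMax volume (fun i => resolventKernel d (2 ^ i * 2⁻¹ ^ n)) (2 * n + 1) f x

theorem measurable_resolventMax {f : EuclideanSpace ℝ (Fin d) → ℝ≥0∞} (hf : Measurable f) :
    Measurable (resolventMax d f) :=
  Measurable.iSup fun _ => measurable_kernelMax (fun _ => measurable_resolventKernel _) _ hf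

theorem lintegral_resolventMax_sq_le {f : EuclideanSpace ℝ (Fin d) → ℝ≥0∞} (hf : Measurable f) :
    ∫⁻ x, resolventMax d f x ^ 2 ≤ 66 * ∫⁻ x, f x ^ 2 := by
  -- Stage n uses the parameters 2^{i-n} with 0 ≤ i ≤ 2n, that is 2^{-n}, …, 2^n. Passing to n + 1
  -- shifts i by one, so the stages are nested and monotone convergence applies.
  have hmono : Monotone fun (n : ℕ) x => kernelMax volume
      (fun i => resolventKernel d (2 ^ i * 2⁻¹ ^ n)) (2 * n + 1) f x ^ 2 := by
    refine monotone_nat_of_le_succ fun n x => pow_le_pow_left' (Finset.sup_le fun i hi => ?_) 2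
    rw [Finset.mem_range] at hi
    have h1 : (2 : ℝ) ^ i * 2⁻¹ ^ n = 2 ^ (i + 1) * 2⁻¹ ^ (n + 1) := by
      rw [pow_succ, pow_succ]
      ring
    dsimp only
    rw [h1]
    exact kernelOp_le_kernelMax (K := fun i => resolventKernel d (2 ^ i * 2⁻¹ ^ (n + 1)))
      (i := i + 1) (by omega) x
  have h2 (x) : resolventMax d f x ^ 2 = ⨆ n : ℕ, kernelMax volume
      (fun i => resolventKernel d (2 ^ i * 2⁻¹ ^ n)) (2 * n + 1) f x ^ 2 := by
    rw [resolventMax]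
    exact (ENNReal.iSup_pow _ _)
  simp only [h2]
  rw [lintegral_iSup (fun n => (measurable_kernelMax
    (fun _ => measurable_resolventKernel _) _ hf).pow_const 2) hmono]
  exact iSup_le fun n => lintegral_kernelMax_sq_le
    (isKernelChain_resolventKernel (by positivity)) _ hf

/-- Rounding τ up to the next power of 2 at most doubles it, and `expDensity_le` then compares the
kernels pointwise with a factor 2. -/
theorem kernelOp_resolventKernel_le {τ : ℝ} (hτ : 0 < τ)
    (f : EuclideanSpace ℝ (Fin d) → ℝ≥0∞) (x : EuclideanSpace ℝ (Fin d)) :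
    kernelOp volume (resolventKernel d τ) f x ≤ 2 * resolventMax d f x := by
  obtain ⟨k, hk1, hk2⟩ : ∃ k : ℤ, (2 : ℝ) ^ k < τ ∧ τ ≤ 2 ^ (k + 1) :=
    exists_mem_Ioc_zpow hτ (by norm_num)
  set σ : ℝ := 2 ^ (k + 1)
  have hσ : σ ≤ 2 * τ := by
    simp only [σ]
    rw [zpow_add_one₀ (by norm_num)]
    linarith
  have h1 (y) : resolventKernel d τ x y ≤ 2 * resolventKernel d σ x y := by
    unfold resolventKernel
    rw [← lintegral_const_mul' _ _ (by norm_num)]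
    refine setLIntegral_mono' measurableSet_Ioi fun s hs => ?_
    rw [← mul_assoc]
    refine mul_le_mul_left ?_ _
    refine (ENNReal.ofReal_le_ofReal (expDensity_le hτ hk2 hσ (le_of_lt hs))).trans ?_
    rw [ENNReal.ofReal_mul (by norm_num)]
    norm_num
  have h2 : kernelOp volume (resolventKernel d τ) f x ≤
      2 * kernelOp volume (resolventKernel d σ) f x := by
    unfold kernelOp
    rw [← lintegral_const_mul' _ _ (by norm_num)]
    refine lintegral_mono fun y => ?_
    rw [← mul_assoc]
    exact mul_le_mul_left (h1 y) _
  refine h2.trans (mul_le_mul_right ?_ _)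
  set n := (k + 1).natAbs
  obtain ⟨i, hi⟩ : ∃ i : ℕ, (i : ℤ) = k + 1 + n := ⟨(k + 1 + n).toNat, by omega⟩
  have h3 : σ = 2 ^ i * 2⁻¹ ^ n := by
    simp only [σ]
    rw [show k + 1 = (i : ℤ) - (n : ℤ) by omega, zpow_sub₀ (by norm_num), zpow_natCast,
      zpow_natCast, inv_pow, div_eq_mul_inv]
  rw [h3]
  refine le_trans ?_ (le_iSup _ n)
  exact kernelOp_le_kernelMax (K := fun i => resolventKernel d (2 ^ i * 2⁻¹ ^ n)) (by omega) x

/-! ### The Fourier transform on `L¹ ∩ L²` -/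

theorem eLpNorm_two_sq {X ε : Type*} [MeasurableSpace X] [ENorm ε] (μ : Measure X) (f : X → ε) :
    eLpNorm f 2 μ ^ 2 = ∫⁻ x, ‖f x‖ₑ ^ 2 ∂μ := by
  have := eLpNorm_nnreal_pow_eq_lintegral (μ := μ) (f := f) (p := 2) two_ne_zero
  simpa using this

section plancherel

variable {V : Type*} [NormedAddCommGroup V] [InnerProductSpace ℝ V] [FiniteDimensional ℝ V]
  [MeasurableSpace V] [BorelSpace V]

theorem integral_fourierInv_mul {f g : V → ℂ} (hf : Integrable f) (hg : Integrable g) :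
    ∫ x, 𝓕⁻ f x * g x = ∫ x, f x * 𝓕⁻ g x := by
  have h := VectorFourier.integral_fourierIntegral_smul_eq_flip (L := -innerₗ V)
    (μ := volume) (ν := volume) Real.continuous_fourierChar
    (by simpa using! continuous_inner.neg) hf hg
  have e : (-innerₗ V).flip = -innerₗ V := by
    ext x y
    simp [real_inner_comm]
  rw [e] at h
  exact h

theorem continuous_fourierInv {f : V → ℂ} (hf : Integrable f) : Continuous (𝓕⁻ f) :=
  VectorFourier.fourierIntegral_continuous Real.continuous_fourierChar
    (by simpa using! continuous_inner.neg) hf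

/-- The L² transform and the integral agree as distributions: against a test function both move the
transform onto it. This is needed because the symbols times Schwartz functions are not Schwartz in
general. -/
theorem coeFn_fourierInv_toLp {h : V → ℂ} (h1 : Integrable h) (h2 : MemLp h 2) :
    (𝓕⁻ (h2.toLp h) : Lp ℂ 2 (volume : Measure V)) =ᵐ[volume] 𝓕⁻ h := by
  refine ae_eq_of_integral_contDiff_smul_eq
    ((Lp.memLp _).locallyIntegrable (by norm_num)) (continuous_fourierInv h1).locallyIntegrable
    fun g hg hgs => ?_
  have hs : HasCompactSupport fun x => (g x : ℂ) := hgs.comp_left Complex.ofReal_zero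
  set G : 𝓢(V, ℂ) := hs.toSchwartzMap (Complex.ofRealCLM.contDiff.comp hg)
  have hG (x) : (g x : ℂ) = G x := rfl
  have e1 := congrArg (fun T => T G)
    (Lp.fourierInv_toTemperedDistribution_eq (h2.toLp h : Lp ℂ 2 (volume : Measure V)))
  simp only [TemperedDistribution.fourierInv_apply, Lp.toTemperedDistribution_apply,
    smul_eq_mul] at e1
  simp only [Complex.real_smul, hG]
  rw [← e1]
  have e2 : ∫ x, (𝓕⁻ G) x * (h2.toLp h) x = ∫ x, 𝓕⁻ (G : V → ℂ) x * h x := by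
    refine integral_congr_ae ?_
    filter_upwards [h2.coeFn_toLp] with x hx
    rw [hx, SchwartzMap.fourierInv_coe]
  rw [e2, integral_fourierInv_mul G.integrable h1]

theorem lintegral_fourierInv_sq {h : V → ℂ} (h1 : Integrable h) (h2 : MemLp h 2) :
    ∫⁻ x, ‖𝓕⁻ h x‖ₑ ^ 2 = ∫⁻ x, ‖h x‖ₑ ^ 2 := by
  rw [← eLpNorm_two_sq, ← eLpNorm_two_sq, ← eLpNorm_congr_ae (coeFn_fourierInv_toLp h1 h2),
    ← eLpNorm_congr_ae h2.coeFn_toLp, ← Lp.enorm_def, ← Lp.enorm_def]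
  congr 1
  rw [← ofReal_norm, ← ofReal_norm, ← Lp.norm_fourier_eq, fourier_fourierInv_eq]

theorem lintegral_fourier_sq (φ : 𝓢(V, ℂ)) : ∫⁻ ξ, ‖𝓕 φ ξ‖ₑ ^ 2 = ∫⁻ x, ‖φ x‖ₑ ^ 2 := by
  rw [← lintegral_fourierInv_sq (h := fun ξ => 𝓕 φ ξ) (𝓕 φ).integrable ((𝓕 φ).memLp 2)]
  refine lintegral_congr fun x => ?_
  rw [← SchwartzMap.fourierInv_coe (𝓕 φ : 𝓢(V, ℂ)), FourierTransform.fourierInv_fourier_eq]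

/-- A bounded symbol times a Schwartz function is integrable. -/
theorem integrable_mul_schwartz {b : V → ℂ} (hb : Measurable b) {C : ℝ} (hC : ∀ ξ, ‖b ξ‖ ≤ C)
    (ψ : 𝓢(V, ℂ)) : Integrable fun ξ => b ξ * ψ ξ :=
  ψ.integrable.bdd_mul hb.aestronglyMeasurable (Filter.Eventually.of_forall hC)

theorem memLp_mul_schwartz {b : V → ℂ} (hb : Measurable b) {C : ℝ} (hC : ∀ ξ, ‖b ξ‖ ≤ C)
    (ψ : 𝓢(V, ℂ)) : MemLp (fun ξ => b ξ * ψ ξ) 2 :=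
  (ψ.memLp 2).mul (memLp_top_of_bound hb.aestronglyMeasurable C (Filter.Eventually.of_forall hC))

end plancherel

/-! ### Domination of the resolvents by positive kernels -/

/-- The modulated Gaussian J has Fourier transform y ↦ `heatKernel d s (x - y)`, and the transform
is moved from φ to J. -/
theorem fourierInv_gaussian_mul_fourier (φ : 𝓢(EuclideanSpace ℝ (Fin d), ℂ)) {s : ℝ} (hs : 0 < s)
    (x : EuclideanSpace ℝ (Fin d)) :
    𝓕⁻ (fun ξ => (Real.exp (-s * ‖ξ‖ ^ 2) : ℂ) * 𝓕 φ ξ) x =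
      ∫ y, (heatKernel d s (x - y) : ℂ) * φ y := by
  set J : EuclideanSpace ℝ (Fin d) → ℂ := fun v =>
    Complex.exp (-(s : ℂ) * ‖v‖ ^ 2 + 2 * Real.pi * Complex.I * inner ℝ x v)
  have hJ : Integrable J :=
    GaussianFourier.integrable_cexp_neg_mul_sq_norm_add (by simpa using hs) _ _
  have h1 : 𝓕⁻ (fun ξ => (Real.exp (-s * ‖ξ‖ ^ 2) : ℂ) * 𝓕 φ ξ) x = ∫ ξ, J ξ * 𝓕 φ ξ := by
    rw [Real.fourierInv_eq']
    refine integral_congr_ae (Filter.Eventually.of_forall fun ξ => ?_)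
    simp only [J, smul_eq_mul]
    rw [Complex.exp_add, real_inner_comm x ξ]
    push_cast
    ring_nf
  have h2 := VectorFourier.integral_fourierIntegral_smul_eq_flip
    (L := innerₗ (EuclideanSpace ℝ (Fin d))) (μ := volume) (ν := volume)
    Real.continuous_fourierChar continuous_inner hJ φ.integrable
  have h3 : ∫ y, 𝓕 J y * φ y = ∫ ξ, J ξ * 𝓕 φ ξ := by
    rw [SchwartzMap.fourier_coe]
    simpa using! h2
  rw [h1, ← h3]
  refine integral_congr_ae (Filter.Eventually.of_forall fun y => ?_)
  simp only [J]
  rw [fourier_gaussian_innerProductSpace' (by simpa using hs), finrank_euclideanSpace_fin,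
    heatKernel]
  push_cast
  rw [Complex.ofReal_cpow (by have := Real.pi_pos; positivity)]
  push_cast
  congr 3
  ring

theorem integral_expDensity_mul_exp {τ : ℝ} (hτ : 0 < τ) (ρ : ℝ) :
    ∫ s in Set.Ioi 0, expDensity τ s * Real.exp (-s * ρ ^ 2) = 1 / (1 + τ * ρ ^ 2) := by
  have hσ : 0 < τ / (1 + τ * ρ ^ 2) := by positivity
  have h1 (s : ℝ) : expDensity τ s * Real.exp (-s * ρ ^ 2) =
      (1 / (1 + τ * ρ ^ 2)) * expDensity (τ / (1 + τ * ρ ^ 2)) s := by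
    unfold expDensity
    have : -s / (τ / (1 + τ * ρ ^ 2)) = -s / τ + -s * ρ ^ 2 := by
      field_simp
      ring
    rw [this, Real.exp_add]
    field_simp
  simp only [h1]
  rw [integral_const_mul, integral_expDensity hσ, mul_one]

/-- Subordination: the resolvent symbol is the average of e^{-s|ξ|²} against the exponential
density, so by Fubini the operator averages convolutions with positive Gaussians. Absolute values
then go inside. -/
theorem enorm_resolvent_le (φ : 𝓢(EuclideanSpace ℝ (Fin d), ℂ)) {τ : ℝ} (hτ : 0 < τ)
    (x : EuclideanSpace ℝ (Fin d)) :
    ‖𝓕⁻ (fun ξ => ((1 / (1 + τ * ‖ξ‖ ^ 2) : ℝ) : ℂ) * 𝓕 φ ξ) x‖ₑ ≤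
      kernelOp volume (resolventKernel d τ) (fun y => ‖φ y‖ₑ) x := by
  set e : EuclideanSpace ℝ (Fin d) → ℝ → ℂ := fun ξ s =>
    Complex.exp ((2 * Real.pi * inner ℝ ξ x : ℝ) * Complex.I) *
      (((expDensity τ s * Real.exp (-s * ‖ξ‖ ^ 2) : ℝ) : ℂ) * 𝓕 φ ξ)
  have h1 : 𝓕⁻ (fun ξ => ((1 / (1 + τ * ‖ξ‖ ^ 2) : ℝ) : ℂ) * 𝓕 φ ξ) x =
      ∫ ξ, ∫ s in Set.Ioi 0, e ξ s := by
    rw [Real.fourierInv_eq']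
    refine integral_congr_ae (Filter.Eventually.of_forall fun ξ => ?_)
    simp only [e, smul_eq_mul]
    rw [integral_const_mul, integral_mul_const, integral_complex_ofReal,
      integral_expDensity_mul_exp hτ]
  have hint : Integrable (Function.uncurry e)
      ((volume : Measure (EuclideanSpace ℝ (Fin d))).prod (volume.restrict (Set.Ioi 0))) := by
    refine Integrable.mono' (((𝓕 φ).integrable.norm).mul_prod
      (ν := volume.restrict (Set.Ioi (0 : ℝ))) (integrableOn_expDensity hτ)) ?_ ?_
    · have hφ : Measurable fun ξ => 𝓕 φ ξ := (𝓕 φ).continuous.measurable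
      have := measurable_expDensity τ
      refine Measurable.aestronglyMeasurable ?_
      simp only [e, Function.uncurry_def]
      fun_prop
    · have hmem : ∀ᵐ p ∂((volume : Measure (EuclideanSpace ℝ (Fin d))).prod
          (volume.restrict (Set.Ioi (0 : ℝ)))), p.2 ∈ Set.Ioi (0 : ℝ) :=
        Measure.quasiMeasurePreserving_snd.ae (ae_restrict_mem measurableSet_Ioi)
      filter_upwards [hmem] with p hp
      have hp' : 0 < p.2 := hp
      simp only [e, Function.uncurry_def, norm_mul, Complex.norm_exp_ofReal_mul_I, one_mul,
        Complex.norm_real, Real.norm_of_nonneg (expDensity_nonneg hτ _), Real.norm_eq_abs,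
        Real.abs_exp]
      rw [mul_comm]
      refine mul_le_mul_of_nonneg_left ?_ (norm_nonneg _)
      refine mul_le_of_le_one_right (expDensity_nonneg hτ _) ?_
      rw [Real.exp_le_one_iff]
      nlinarith [sq_nonneg ‖p.1‖]
  have h2 : ∀ s ∈ Set.Ioi (0 : ℝ), ‖∫ ξ, e ξ s‖ₑ ≤
      ∫⁻ y, ENNReal.ofReal (expDensity τ s) * ENNReal.ofReal (heatKernel d s (x - y)) *
        ‖φ y‖ₑ := by
    intro s hs
    have h3 : ∫ ξ, e ξ s = (expDensity τ s : ℂ) * ∫ y, (heatKernel d s (x - y) : ℂ) * φ y := by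
      rw [← fourierInv_gaussian_mul_fourier φ hs, Real.fourierInv_eq', ← integral_const_mul]
      refine integral_congr_ae (Filter.Eventually.of_forall fun ξ => ?_)
      simp only [e, smul_eq_mul]
      push_cast
      ring
    have h4 (r : ℝ) (hr : 0 ≤ r) : ‖(r : ℂ)‖ₑ = ENNReal.ofReal r := by
      rw [← ofReal_norm, Complex.norm_real, Real.norm_of_nonneg hr]
    rw [h3, enorm_mul, h4 _ (expDensity_nonneg hτ s)]
    refine (mul_le_mul_right (enorm_integral_le_lintegral_enorm _) _).trans (le_of_eq ?_)
    rw [← lintegral_const_mul' _ _ ENNReal.ofReal_ne_top]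
    refine lintegral_congr fun y => ?_
    rw [enorm_mul, h4 _ (heatKernel_nonneg (le_of_lt hs) _), mul_assoc]
  have hφm : Measurable fun y => ‖φ y‖ₑ := φ.continuous.measurable.enorm
  rw [h1, integral_integral_swap hint]
  refine (enorm_integral_le_lintegral_enorm _).trans ?_
  refine (setLIntegral_mono' measurableSet_Ioi h2).trans (le_of_eq ?_)
  have hm : Measurable fun p : EuclideanSpace ℝ (Fin d) × ℝ =>
      ENNReal.ofReal (expDensity τ p.2) * ENNReal.ofReal (heatKernel d p.2 (x - p.1)) :=
    (measurable_expDensity_mul_heatKernel τ).comp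
      (f := fun p : EuclideanSpace ℝ (Fin d) × ℝ => ((x, p.1), p.2)) (by fun_prop)
  rw [← lintegral_lintegral_swap
    (f := fun y s => ENNReal.ofReal (expDensity τ s) * ENNReal.ofReal (heatKernel d s (x - y)) *
        ‖φ y‖ₑ) (hm.fun_mul (hφm.comp measurable_fst)).aemeasurable]
  refine lintegral_congr fun y => ?_
  rw [resolventKernel, lintegral_mul_const _ (show Measurable fun s => ENNReal.ofReal (expDensity τ s) *
    ENNReal.ofReal (heatKernel d s (x - y)) from
    hm.comp (f := fun s : ℝ => (y, s)) (by fun_prop))]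

/-! ### The square function estimate -/

section square

variable {V : Type*} [NormedAddCommGroup V] [InnerProductSpace ℝ V] [FiniteDimensional ℝ V]
  [MeasurableSpace V] [BorelSpace V]

/-- The value at `x` of the radial Fourier multiplier with symbol `b(s|ξ|)` applied to the inverse
Fourier transform of `ψ`. -/
def radialOp (b : ℝ → ℂ) (ψ : 𝓢(V, ℂ)) (s : ℝ) (x : V) : ℂ :=
  𝓕⁻ (fun ξ : V => b (s * ‖ξ‖) * ψ ξ) x

/-- The derivative of `radialOp b ψ s x` in `s`, where `b'` is the derivative of `b`. -/
def radialOpDeriv (b' : ℝ → ℂ) (ψ : 𝓢(V, ℂ)) (s : ℝ) (x : V) : ℂ :=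
  𝓕⁻ (fun ξ : V => (‖ξ‖ : ℂ) * b' (s * ‖ξ‖) * ψ ξ) x

variable {b b' : ℝ → ℂ} {ψ : 𝓢(V, ℂ)} {C : ℝ}

theorem continuousOn_radialOp (hb : Continuous b) (hC : ∀ x, 0 ≤ x → ‖b x‖ ≤ C) (x : V) :
    ContinuousOn (fun s => radialOp b ψ s x) (Set.Ici 0) := by
  unfold radialOp
  simp only [Real.fourierInv_eq']
  have hψ := ψ.continuous
  refine continuousOn_of_dominated (bound := fun ξ => C * ‖ψ ξ‖)
    (fun s hs => Continuous.aestronglyMeasurable (by fun_prop))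
    (fun s hs => Filter.Eventually.of_forall fun ξ => ?_) (ψ.integrable.norm.const_mul C)
    (Filter.Eventually.of_forall fun ξ => Continuous.continuousOn (by fun_prop))
  rw [norm_smul, Complex.norm_exp_ofReal_mul_I, one_mul, norm_mul]
  exact mul_le_mul_of_nonneg_right (hC _ (mul_nonneg hs (norm_nonneg _))) (norm_nonneg _)

theorem integrable_norm_mul_schwartz (ψ : 𝓢(V, ℂ)) : Integrable fun ξ => ‖ξ‖ * ‖ψ ξ‖ := by
  simpa using ψ.integrable_pow_mul volume 1

theorem continuousOn_radialOpDeriv (hb : Continuous b') (hC : ∀ x, 0 ≤ x → ‖b' x‖ ≤ C) (x : V) :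
    ContinuousOn (fun s => radialOpDeriv b' ψ s x) (Set.Ici 0) := by
  unfold radialOpDeriv
  simp only [Real.fourierInv_eq']
  have hψ := ψ.continuous
  refine continuousOn_of_dominated (bound := fun ξ => C * (‖ξ‖ * ‖ψ ξ‖))
    (fun s hs => Continuous.aestronglyMeasurable (by fun_prop))
    (fun s hs => Filter.Eventually.of_forall fun ξ => ?_)
    ((integrable_norm_mul_schwartz ψ).const_mul C)
    (Filter.Eventually.of_forall fun ξ => Continuous.continuousOn (by fun_prop))
  rw [norm_smul, Complex.norm_exp_ofReal_mul_I, one_mul, norm_mul, norm_mul, Complex.norm_real,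
    norm_norm]
  calc _ ≤ ‖ξ‖ * C * ‖ψ ξ‖ := by
        gcongr
        exact hC _ (mul_nonneg hs (norm_nonneg _))
    _ = _ := by ring

theorem hasDerivAt_radialOp (hb : ∀ x, HasDerivAt b (b' x) x) (hb' : Continuous b') {C' : ℝ}
    (hC : ∀ x, 0 ≤ x → ‖b x‖ ≤ C) (hC' : ∀ x, 0 ≤ x → ‖b' x‖ ≤ C') {s : ℝ} (hs : 0 < s) (x : V) :
    HasDerivAt (fun s => radialOp b ψ s x) (radialOpDeriv b' ψ s x) s := by
  have hbc : Continuous b := continuous_iff_continuousAt.mpr fun x => (hb x).continuousAt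
  have hψ := ψ.continuous
  unfold radialOp radialOpDeriv
  simp only [Real.fourierInv_eq']
  refine (hasDerivAt_integral_of_dominated_loc_of_deriv_le (s := Set.Ioi 0)
    (F := fun s ξ => Complex.exp ((2 * Real.pi * inner ℝ ξ x : ℝ) * Complex.I) •
      (b (s * ‖ξ‖) * ψ ξ))
    (F' := fun s ξ => Complex.exp ((2 * Real.pi * inner ℝ ξ x : ℝ) * Complex.I) •
      ((‖ξ‖ : ℂ) * b' (s * ‖ξ‖) * ψ ξ))
    (bound := fun ξ => C' * (‖ξ‖ * ‖ψ ξ‖)) (Ioi_mem_nhds hs)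
    (Filter.Eventually.of_forall fun s => Continuous.aestronglyMeasurable (by fun_prop)) ?_
    (Continuous.aestronglyMeasurable (by fun_prop))
    (Filter.Eventually.of_forall fun ξ s hs => ?_) ((integrable_norm_mul_schwartz ψ).const_mul C')
    (Filter.Eventually.of_forall fun ξ s _ => ?_)).2
  · refine Integrable.mono' (ψ.integrable.norm.const_mul C)
      (Continuous.aestronglyMeasurable (by fun_prop)) (Filter.Eventually.of_forall fun ξ => ?_)
    rw [norm_smul, Complex.norm_exp_ofReal_mul_I, one_mul, norm_mul]
    exact mul_le_mul_of_nonneg_right (hC _ (by positivity)) (norm_nonneg _)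
  · rw [norm_smul, Complex.norm_exp_ofReal_mul_I, one_mul, norm_mul, norm_mul, Complex.norm_real,
      norm_norm]
    have hs' : 0 < s := hs
    calc _ ≤ ‖ξ‖ * C' * ‖ψ ξ‖ := by
          gcongr
          exact hC' _ (by positivity)
      _ = _ := by ring
  · have h1 : HasDerivAt (fun s : ℝ => s * ‖ξ‖) ‖ξ‖ s := by
      simpa using (hasDerivAt_id s).mul_const ‖ξ‖
    have h2 := (((hb (s * ‖ξ‖)).scomp s h1).mul_const (ψ ξ)).const_smul
      (Complex.exp ((2 * Real.pi * inner ℝ ξ x : ℝ) * Complex.I))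
    simpa [Complex.real_smul] using! h2

/-- The pointwise square function controlling `sup_s |radialOp b ψ s x|²`. -/
def squareFunction (b b' : ℝ → ℂ) (ψ : 𝓢(V, ℂ)) (x : V) : ℝ≥0∞ :=
  ∫⁻ s in Set.Ioi (0 : ℝ), (ENNReal.ofReal s⁻¹ * ‖radialOp b ψ s x‖ₑ ^ 2 +
    ENNReal.ofReal s * ‖radialOpDeriv b' ψ s x‖ₑ ^ 2)

/-- Integrate the derivative 2⟨B, B'⟩ of |B|² from ε to t and use 2|B||B'| ≤ |B|²/s + s|B'|². Since
b(0) = 0, the boundary term vanishes as ε → 0. -/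
theorem enorm_radialOp_sq_le (hb : ∀ x, HasDerivAt b (b' x) x) (hb' : Continuous b') {C' : ℝ}
    (hC : ∀ x, 0 ≤ x → ‖b x‖ ≤ C) (hC' : ∀ x, 0 ≤ x → ‖b' x‖ ≤ C') (h0 : b 0 = 0) {t : ℝ}
    (ht : 0 < t) (x : V) : ‖radialOp b ψ t x‖ₑ ^ 2 ≤ squareFunction b b' ψ x := by
  have hbc : Continuous b := continuous_iff_continuousAt.mpr fun x => (hb x).continuousAt
  set B := fun s => radialOp b ψ s x
  set B' := fun s => radialOpDeriv b' ψ s x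
  have hBc : ContinuousOn B (Set.Ici 0) := continuousOn_radialOp hbc hC x
  have hBc' : ContinuousOn B' (Set.Ici 0) := continuousOn_radialOpDeriv hb' hC' x
  have hB (s : ℝ) (hs : 0 < s) : HasDerivAt B (B' s) s := hasDerivAt_radialOp hb hb' hC hC' hs x
  have hB0 : B 0 = 0 := by
    simp [B, radialOp, Real.fourierInv_eq', h0]
  have hsub (ε : ℝ) (hε : ε ∈ Set.Ioo 0 t) : Set.uIcc ε t ⊆ Set.Ioi 0 := by
    rw [Set.uIcc_of_le hε.2.le]
    exact fun s hs => hε.1.trans_le hs.1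
  have key : ∀ ε ∈ Set.Ioo 0 t, ENNReal.ofReal (‖B t‖ ^ 2) ≤
      ENNReal.ofReal (‖B ε‖ ^ 2) + squareFunction b b' ψ x := by
    intro ε hε
    have hc : ContinuousOn (fun s => 2 * inner ℝ (B s) (B' s)) (Set.uIcc ε t) :=
      continuousOn_const.mul (ContinuousOn.inner (𝕜 := ℝ)
        (hBc.mono ((hsub ε hε).trans Set.Ioi_subset_Ici_self))
        (hBc'.mono ((hsub ε hε).trans Set.Ioi_subset_Ici_self)))
    have h1 := intervalIntegral.integral_eq_sub_of_hasDerivAt (a := ε) (b := t)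
      (fun s hs => (hB s (hsub ε hε hs)).norm_sq) hc.intervalIntegrable
    have h2 : ‖B t‖ ^ 2 = ‖B ε‖ ^ 2 + ∫ s in ε..t, 2 * inner ℝ (B s) (B' s) := by
      rw [h1]
      ring
    rw [h2]
    refine ENNReal.ofReal_add_le.trans (add_le_add_right ?_ _)
    rw [intervalIntegral.integral_of_le hε.2.le]
    refine (ENNReal.ofReal_le_ofReal (Real.le_norm_self _)).trans ?_
    rw [ofReal_norm]
    refine (enorm_integral_le_lintegral_enorm _).trans ?_
    refine (lintegral_mono_set (fun s hs => hε.1.trans hs.1)).trans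
      (setLIntegral_mono' measurableSet_Ioi fun s hs => ?_)
    have hs' : 0 < s := hs
    have h3 : ‖2 * inner ℝ (B s) (B' s)‖ ≤ s⁻¹ * ‖B s‖ ^ 2 + s * ‖B' s‖ ^ 2 := by
      have h4 : ‖inner ℝ (B s) (B' s)‖ ≤ ‖B s‖ * ‖B' s‖ := norm_inner_le_norm _ _
      rw [norm_mul, Real.norm_ofNat]
      have h5 : 2 * (‖B s‖ * ‖B' s‖) ≤ s⁻¹ * ‖B s‖ ^ 2 + s * ‖B' s‖ ^ 2 := by
        have h6 : 0 ≤ s⁻¹ * (‖B s‖ - s * ‖B' s‖) ^ 2 := by positivity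
        have h7 : s⁻¹ * (‖B s‖ - s * ‖B' s‖) ^ 2 =
            s⁻¹ * ‖B s‖ ^ 2 + s * ‖B' s‖ ^ 2 - 2 * (‖B s‖ * ‖B' s‖) := by
          field_simp
          ring
        linarith
      linarith
    rw [← ofReal_norm]
    refine (ENNReal.ofReal_le_ofReal h3).trans (le_of_eq ?_)
    rw [ENNReal.ofReal_add (by positivity) (by positivity), ENNReal.ofReal_mul (by positivity),
      ENNReal.ofReal_mul hs'.le, ENNReal.ofReal_pow (norm_nonneg _),
      ENNReal.ofReal_pow (norm_nonneg _), ofReal_norm, ofReal_norm]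
  have hlim : Filter.Tendsto (fun ε => ENNReal.ofReal (‖B ε‖ ^ 2) + squareFunction b b' ψ x)
      (nhdsWithin 0 (Set.Ioo 0 t)) (nhds (0 + squareFunction b b' ψ x)) := by
    refine Filter.Tendsto.add_const _ ?_
    have h1 : Filter.Tendsto B (nhdsWithin 0 (Set.Ioo 0 t)) (nhds 0) := by
      have := (hBc 0 Set.self_mem_Ici).mono_left (nhdsWithin_mono 0
        (show Set.Ioo 0 t ⊆ Set.Ici 0 from fun s hs => hs.1.le))
      rwa [hB0] at this
    have h2 := ENNReal.tendsto_ofReal (h1.norm.pow 2)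
    simpa using h2
  have : (nhdsWithin 0 (Set.Ioo 0 t)).NeBot := by
    rw [nhdsWithin_Ioo_eq_nhdsGT ht]
    infer_instance
  have := ge_of_tendsto hlim (by filter_upwards [self_mem_nhdsWithin] with ε hε using key ε hε)
  rwa [zero_add, ENNReal.ofReal_pow (norm_nonneg _), ofReal_norm] at this

/-! ### Integrating the square function -/

theorem measurable_radialOp (hb : Measurable b) :
    Measurable fun p : V × ℝ => radialOp b ψ p.2 p.1 := by
  unfold radialOp
  simp only [Real.fourierInv_eq']
  refine (StronglyMeasurable.integral_prod_right' (ν := volume)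
    (f := fun p : (V × ℝ) × V => Complex.exp ((2 * Real.pi * inner ℝ p.2 p.1.1 : ℝ) * Complex.I) •
      (b (p.1.2 * ‖p.2‖) * ψ p.2)) (Measurable.stronglyMeasurable ?_)).measurable
  have hψ := ψ.continuous.measurable
  fun_prop

theorem measurable_radialOpDeriv (hb : Measurable b') :
    Measurable fun p : V × ℝ => radialOpDeriv b' ψ p.2 p.1 := by
  unfold radialOpDeriv
  simp only [Real.fourierInv_eq']
  refine (StronglyMeasurable.integral_prod_right' (ν := volume)
    (f := fun p : (V × ℝ) × V => Complex.exp ((2 * Real.pi * inner ℝ p.2 p.1.1 : ℝ) * Complex.I) •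
      ((‖p.2‖ : ℂ) * b' (p.1.2 * ‖p.2‖) * ψ p.2)) (Measurable.stronglyMeasurable ?_)).measurable
  have hψ := ψ.continuous.measurable
  fun_prop

theorem measurable_squareFunction (hb : Measurable b) (hb' : Measurable b') :
    Measurable (squareFunction b b' ψ) := by
  have h1 := measurable_radialOp (ψ := ψ) hb
  have h2 := measurable_radialOpDeriv (ψ := ψ) hb'
  exact Measurable.lintegral_prod_right' (ν := volume.restrict (Set.Ioi (0 : ℝ)))
    (f := fun p : V × ℝ => ENNReal.ofReal p.2⁻¹ * ‖radialOp b ψ p.2 p.1‖ₑ ^ 2 +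
      ENNReal.ofReal p.2 * ‖radialOpDeriv b' ψ p.2 p.1‖ₑ ^ 2) (by fun_prop)

theorem hasDerivAt_neg_inv_one_add_sq (c s : ℝ) :
    HasDerivAt (fun s => -(1 + (c * s) ^ 2)⁻¹) (2 * c ^ 2 * s / (1 + (c * s) ^ 2) ^ 2) s := by
  have h1 : HasDerivAt (fun s : ℝ => 1 + (c * s) ^ 2) (2 * c ^ 2 * s) s := by
    have := ((((hasDerivAt_id s).const_mul c).pow 2)).const_add 1
    convert! this using 1
    simp
    ring
  have h2 := (h1.inv (by positivity : 1 + (c * s) ^ 2 ≠ 0)).neg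
  convert! h2 using 1
  ring

theorem lintegral_sq_div_le {c : ℝ} (hc : 0 ≤ c) :
    ∫⁻ s in Set.Ioi (0 : ℝ), ENNReal.ofReal (2 * c ^ 2 * s / (1 + (c * s) ^ 2) ^ 2) ≤ 1 := by
  rcases hc.eq_or_lt with rfl | hc
  · simp
  have hlim : Filter.Tendsto (fun s => -(1 + (c * s) ^ 2)⁻¹) Filter.atTop (nhds 0) := by
    rw [← neg_zero]
    refine (Filter.Tendsto.inv_tendsto_atTop ?_).neg
    refine Filter.tendsto_atTop_add_const_left _ _ ?_
    exact (Filter.tendsto_pow_atTop two_ne_zero).comp (Filter.tendsto_id.const_mul_atTop hc)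
  have hpos : ∀ s ∈ Set.Ioi (0 : ℝ), 0 ≤ 2 * c ^ 2 * s / (1 + (c * s) ^ 2) ^ 2 := fun s hs => by
    have : 0 < s := hs
    positivity
  rw [← ofReal_integral_eq_lintegral_ofReal
    (integrableOn_Ioi_deriv_of_nonneg' (fun s _ => hasDerivAt_neg_inv_one_add_sq c s) hpos hlim)
    ((ae_restrict_mem measurableSet_Ioi).mono fun s hs => hpos s hs),
    integral_Ioi_of_hasDerivAt_of_nonneg' (fun s _ => hasDerivAt_neg_inv_one_add_sq c s) hpos hlim]
  simp

/-- Plancherel at each s and Tonelli reduce the claim to an integral in s for fixed ξ. With v =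
cs|ξ| the two hypotheses bound its integrand by 2A² s⁻¹ v²/(1 + v²)², the derivative of -A²/(1 +
v²), so the total is at most A² for every ξ. -/
theorem lintegral_squareFunction_le (hb : Continuous b) (hb' : Continuous b') {A c : ℝ}
    (hc : 0 ≤ c) (hC : ∀ x, 0 ≤ x → ‖b x‖ ≤ C)
    (h1 : ∀ x, 0 ≤ x → ‖b x‖ ≤ A * (c * x / (1 + (c * x) ^ 2)))
    (h2 : ∀ x, 0 ≤ x → x * ‖b' x‖ ≤ A * (c * x / (1 + (c * x) ^ 2))) :
    ∫⁻ x, squareFunction b b' ψ x ≤ ENNReal.ofReal (A ^ 2) * ∫⁻ ξ, ‖ψ ξ‖ₑ ^ 2 := by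
  have m1 := measurable_radialOp (ψ := ψ) hb.measurable
  have m2 := measurable_radialOpDeriv (ψ := ψ) hb'.measurable
  have hψ := ψ.continuous.measurable
  have hψn : Measurable fun ξ => ‖ψ ξ‖ₑ ^ 2 := by fun_prop
  have hbm := hb.measurable
  have hbm' := hb'.measurable
  have e1 (s : ℝ) (hs : s ∈ Set.Ioi (0 : ℝ)) :
      ∫⁻ x, ‖radialOp b ψ s x‖ₑ ^ 2 = ∫⁻ ξ, ‖b (s * ‖ξ‖)‖ₑ ^ 2 * ‖ψ ξ‖ₑ ^ 2 := by
    have hs' : 0 < s := hs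
    have hB (ξ : V) : ‖b (s * ‖ξ‖)‖ ≤ C := hC _ (by positivity)
    unfold radialOp
    rw [lintegral_fourierInv_sq (integrable_mul_schwartz (by fun_prop) hB ψ)
      (memLp_mul_schwartz (by fun_prop) hB ψ)]
    simp only [enorm_mul, mul_pow]
  have e2 (s : ℝ) (hs : s ∈ Set.Ioi (0 : ℝ)) :
      ∫⁻ x, ‖radialOpDeriv b' ψ s x‖ₑ ^ 2 =
        ∫⁻ ξ, (‖(‖ξ‖ : ℂ) * b' (s * ‖ξ‖)‖ₑ) ^ 2 * ‖ψ ξ‖ₑ ^ 2 := by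
    have hs' : 0 < s := hs
    -- Only boundedness for fixed s is needed here, to place the product in L¹ ∩ L².
    have hB (ξ : V) : ‖(‖ξ‖ : ℂ) * b' (s * ‖ξ‖)‖ ≤ |A| * s⁻¹ := by
      have h3 := h2 (s * ‖ξ‖) (by positivity)
      have h4 : c * (s * ‖ξ‖) / (1 + (c * (s * ‖ξ‖)) ^ 2) ≤ 1 := by
        rw [div_le_one (by positivity)]
        nlinarith [sq_nonneg (c * (s * ‖ξ‖) - 1)]
      have h5 : A * (c * (s * ‖ξ‖) / (1 + (c * (s * ‖ξ‖)) ^ 2)) ≤ |A| := by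
        refine (mul_le_mul_of_nonneg_right (le_abs_self A) (by positivity)).trans ?_
        exact mul_le_of_le_one_right (abs_nonneg _) h4
      rw [norm_mul, Complex.norm_real, norm_norm, ← div_eq_mul_inv, le_div_iff₀ hs']
      linarith
    unfold radialOpDeriv
    rw [lintegral_fourierInv_sq (integrable_mul_schwartz (by fun_prop) hB ψ)
      (memLp_mul_schwartz (by fun_prop) hB ψ)]
    simp only [enorm_mul, mul_pow]
  have e3 (s : ℝ) (hs : s ∈ Set.Ioi (0 : ℝ)) (ξ : V) :
      ENNReal.ofReal s⁻¹ * ‖b (s * ‖ξ‖)‖ₑ ^ 2 +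
        ENNReal.ofReal s * ‖(‖ξ‖ : ℂ) * b' (s * ‖ξ‖)‖ₑ ^ 2 ≤ ENNReal.ofReal (A ^ 2) *
          ENNReal.ofReal (2 * (c * ‖ξ‖) ^ 2 * s / (1 + (c * ‖ξ‖ * s) ^ 2) ^ 2) := by
    have hs' : 0 < s := hs
    have h3 := h1 (s * ‖ξ‖) (by positivity)
    have h4 := h2 (s * ‖ξ‖) (by positivity)
    rw [← ofReal_norm, ← ofReal_norm, ← ENNReal.ofReal_pow (norm_nonneg _),
      ← ENNReal.ofReal_pow (norm_nonneg _), ← ENNReal.ofReal_mul (by positivity),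
      ← ENNReal.ofReal_mul hs'.le, ← ENNReal.ofReal_add (by positivity) (by positivity),
      ← ENNReal.ofReal_mul (by positivity)]
    refine ENNReal.ofReal_le_ofReal ?_
    rw [norm_mul, Complex.norm_real, norm_norm]
    calc _ = s⁻¹ * (‖b (s * ‖ξ‖)‖ ^ 2 + (s * ‖ξ‖ * ‖b' (s * ‖ξ‖)‖) ^ 2) := by
          field_simp
      _ ≤ s⁻¹ * ((A * (c * (s * ‖ξ‖) / (1 + (c * (s * ‖ξ‖)) ^ 2))) ^ 2 +
            (A * (c * (s * ‖ξ‖) / (1 + (c * (s * ‖ξ‖)) ^ 2))) ^ 2) := by gcongr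
      _ = _ := by
          rw [show c * ‖ξ‖ * s = c * (s * ‖ξ‖) by ring]
          field_simp
          ring
  have hw : Measurable fun p : ℝ × V =>
      ENNReal.ofReal (2 * (c * ‖p.2‖) ^ 2 * p.1 / (1 + (c * ‖p.2‖ * p.1) ^ 2) ^ 2) := by
    fun_prop
  calc ∫⁻ x, squareFunction b b' ψ x
      = ∫⁻ s in Set.Ioi (0 : ℝ), ∫⁻ x, (ENNReal.ofReal s⁻¹ * ‖radialOp b ψ s x‖ₑ ^ 2 +
          ENNReal.ofReal s * ‖radialOpDeriv b' ψ s x‖ₑ ^ 2) := by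
        unfold squareFunction
        refine lintegral_lintegral_swap (Measurable.aemeasurable ?_)
        simp only [Function.uncurry_def]
        fun_prop
    _ ≤ ∫⁻ s in Set.Ioi (0 : ℝ), ∫⁻ ξ : V, ENNReal.ofReal (A ^ 2) *
          ENNReal.ofReal (2 * (c * ‖ξ‖) ^ 2 * s / (1 + (c * ‖ξ‖ * s) ^ 2) ^ 2) * ‖ψ ξ‖ₑ ^ 2 := by
        refine setLIntegral_mono' measurableSet_Ioi fun s hs => ?_
        have m3 : Measurable fun x => radialOp b ψ s x :=
          m1.comp (f := fun x : V => (x, s)) (by fun_prop)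
        have m4 : Measurable fun x => radialOpDeriv b' ψ s x :=
          m2.comp (f := fun x : V => (x, s)) (by fun_prop)
        rw [lintegral_add_left (by fun_prop), lintegral_const_mul _ (by fun_prop),
          lintegral_const_mul _ (by fun_prop), e1 s hs, e2 s hs,
          ← lintegral_const_mul _ (by fun_prop), ← lintegral_const_mul _ (by fun_prop),
          ← lintegral_add_left (by fun_prop)]
        refine lintegral_mono fun ξ => ?_
        rw [← mul_assoc, ← mul_assoc, ← add_mul]
        exact mul_le_mul_left (e3 s hs ξ) _
    _ = ∫⁻ ξ : V, ∫⁻ s in Set.Ioi (0 : ℝ), ENNReal.ofReal (A ^ 2) *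
          ENNReal.ofReal (2 * (c * ‖ξ‖) ^ 2 * s / (1 + (c * ‖ξ‖ * s) ^ 2) ^ 2) * ‖ψ ξ‖ₑ ^ 2 := by
        refine lintegral_lintegral_swap (Measurable.aemeasurable ?_)
        simp only [Function.uncurry_def]
        fun_prop
    _ ≤ ∫⁻ ξ : V, ENNReal.ofReal (A ^ 2) * ‖ψ ξ‖ₑ ^ 2 := by
        refine lintegral_mono fun ξ => ?_
        rw [lintegral_mul_const _ (by fun_prop), lintegral_const_mul _ (by fun_prop)]
        refine mul_le_mul_left ?_ _
        exact mul_le_of_le_one_right' (lintegral_sq_div_le (by positivity))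
    _ = _ := lintegral_const_mul _ hψn

end square

/-! ### Schwartz functions -/

theorem schwartzValue_eq_radialOp (hd : 4 ≤ d) (φ : 𝓢(EuclideanSpace ℝ (Fin d), ℂ))
    (t : Set.Ioi (0 : ℝ)) (x : EuclideanSpace ℝ (Fin d)) :
    schwartzValue φ t x = radialOp (profileExt d) (𝓕 φ) t x := by
  unfold schwartzValue radialOp
  have h : (fun ξ : EuclideanSpace ℝ (Fin d) => profile d (t * ‖ξ‖) * 𝓕 φ ξ) =
      fun ξ => profileExt d (t * ‖ξ‖) * 𝓕 φ ξ :=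
    funext fun ξ => by rw [profileExt_eq hd (mul_nonneg (le_of_lt t.2) (norm_nonneg ξ))]
  rw [h]

theorem continuous_schwartzValue (hd : 4 ≤ d) (φ : 𝓢(EuclideanSpace ℝ (Fin d), ℂ))
    (x : EuclideanSpace ℝ (Fin d)) : Continuous fun t => schwartzValue φ t x := by
  simp only [schwartzValue_eq_radialOp hd]
  obtain ⟨C, hC⟩ := norm_profile_le d
  have h := continuousOn_radialOp (ψ := 𝓕 φ) (b := profileExt d)
    (continuous_iff_continuousAt.mpr fun x => (hasDerivAt_profileExt x).continuousAt)
    (fun x hx => by rw [profileExt_eq hd hx]; exact hC x hx) x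
  exact h.comp_continuous continuous_subtype_val fun t => (Set.mem_Ioi.mp t.2).le

theorem integrable_profile_mul (φ : 𝓢(EuclideanSpace ℝ (Fin d), ℂ)) (t : Set.Ioi (0 : ℝ)) :
    Integrable fun ξ : EuclideanSpace ℝ (Fin d) => profile d (t * ‖ξ‖) * 𝓕 φ ξ := by
  obtain ⟨C, hC⟩ := norm_profile_le d
  exact integrable_mul_schwartz ((measurable_profile d).comp (by fun_prop))
    (fun ξ => hC _ (mul_nonneg (le_of_lt t.2) (norm_nonneg ξ))) _

theorem memLp_profile_mul (φ : 𝓢(EuclideanSpace ℝ (Fin d), ℂ)) (t : Set.Ioi (0 : ℝ)) :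
    MemLp (fun ξ : EuclideanSpace ℝ (Fin d) => profile d (t * ‖ξ‖) * 𝓕 φ ξ) 2 := by
  obtain ⟨C, hC⟩ := norm_profile_le d
  exact memLp_mul_schwartz ((measurable_profile d).comp (by fun_prop))
    (fun ξ => hC _ (mul_nonneg (le_of_lt t.2) (norm_nonneg ξ))) _

theorem schwartzValue_ae_eq (φ : 𝓢(EuclideanSpace ℝ (Fin d), ℂ)) (t : Set.Ioi (0 : ℝ)) :
    schwartzValue φ t =ᵐ[volume] multiplierOp t (φ.toLp 2 volume) := by
  have h : multiplierOp t (φ.toLp 2 volume) =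
      𝓕⁻ ((memLp_profile_mul φ t).toLp _ : Lp ℂ 2 (volume : Measure (EuclideanSpace ℝ (Fin d)))) := by
    unfold multiplierOp
    dsimp only
    congr 1
    rw [SchwartzMap.toLp_fourier_eq]
    refine Lp.ext ((Lp.coeFn_lpSMul _ _).trans ?_)
    filter_upwards [(memLp_symbol (d := d) t).coeFn_toLp, (𝓕 φ).coeFn_toLp 2 volume,
      (memLp_profile_mul φ t).coeFn_toLp] with ξ h1 h2 h3
    rw [Pi.smul_apply', h1, h2, h3, smul_eq_mul]
  rw [h]
  exact (coeFn_fourierInv_toLp (integrable_profile_mul φ t) (memLp_profile_mul φ t)).symm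

theorem isContinuousVersion_schwartzValue (hd : 4 ≤ d) (φ : 𝓢(EuclideanSpace ℝ (Fin d), ℂ)) :
    IsContinuousVersion (φ.toLp 2 volume) (schwartzValue φ) :=
  ⟨schwartzValue_ae_eq φ, Filter.Eventually.of_forall (continuous_schwartzValue hd φ)⟩

theorem measurable_maximalFunction_schwartzValue (φ : 𝓢(EuclideanSpace ℝ (Fin d), ℂ)) :
    Measurable (maximalFunction (schwartzValue φ)) := by
  refine LowerSemicontinuous.measurable ?_
  exact lowerSemicontinuous_iSup fun t => Continuous.lowerSemicontinuous
    (continuous_fourierInv (integrable_profile_mul φ t)).enorm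

theorem schwartzValue_sub (φ ψ : 𝓢(EuclideanSpace ℝ (Fin d), ℂ)) (t : Set.Ioi (0 : ℝ))
    (x : EuclideanSpace ℝ (Fin d)) :
    schwartzValue (φ - ψ) t x = schwartzValue φ t x - schwartzValue ψ t x := by
  have h (φ : 𝓢(EuclideanSpace ℝ (Fin d), ℂ)) : Integrable fun ξ : EuclideanSpace ℝ (Fin d) =>
      Complex.exp ((2 * Real.pi * inner ℝ ξ x : ℝ) * Complex.I) •
        (profile d (t * ‖ξ‖) * 𝓕 φ ξ) := by
    refine (integrable_profile_mul φ t).bdd_mul (c := 1)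
      (Continuous.aestronglyMeasurable (by fun_prop)) (Filter.Eventually.of_forall fun ξ => ?_)
    rw [Complex.norm_exp_ofReal_mul_I]
  unfold schwartzValue
  simp only [Real.fourierInv_eq']
  rw [← integral_sub (h φ) (h ψ)]
  refine integral_congr_ae (Filter.Eventually.of_forall fun ξ => ?_)
  have : 𝓕 (φ - ψ) = 𝓕 φ - 𝓕 ψ := sub_eq_add_neg φ ψ ▸ by
    rw [FourierTransform.fourier_add, FourierTransform.fourier_neg, sub_eq_add_neg]
  simp only [this, sub_apply, smul_eq_mul]
  ring

theorem ennreal_add_sq_le (a b : ℝ≥0∞) : (a + b) ^ 2 ≤ 2 * (a ^ 2 + b ^ 2) := by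
  have := ENNReal.rpow_add_le_mul_rpow_add_rpow a b (p := 2) (by norm_num)
  norm_num at this
  exact this

theorem norm_diffSymbol_le_const (hd : 4 ≤ d) {x : ℝ} (hx : 0 ≤ x) : ‖diffSymbol d x‖ ≤ 16 := by
  refine (norm_diffSymbol_le hd hx).trans ?_
  have : 2 * Real.pi / scale d * x / (1 + (2 * Real.pi / scale d * x) ^ 2) ≤ 1 := by
    rw [div_le_one (by positivity)]
    nlinarith [sq_nonneg (2 * Real.pi / scale d * x - 1)]
  linarith

/-- The constant 128 is 2 · (4 · 2)²: |m(0)| ≤ 4, a factor 2 from dyadic rounding, and 2 from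
squaring a sum. -/
theorem enorm_schwartzValue_sq_le (hd : 4 ≤ d) (φ : 𝓢(EuclideanSpace ℝ (Fin d), ℂ))
    (t : Set.Ioi (0 : ℝ)) (x : EuclideanSpace ℝ (Fin d)) :
    ‖schwartzValue φ t x‖ₑ ^ 2 ≤
      2 * squareFunction (diffSymbol d) (diffSymbolDeriv d) (𝓕 φ) x +
        128 * resolventMax d (fun y => ‖φ y‖ₑ) x ^ 2 := by
  have ht : (0 : ℝ) < t := t.2
  have hD := scale_pos hd
  have hpi := Real.pi_pos
  obtain ⟨C', hC'⟩ := exists_norm_diffSymbolDeriv_le hd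
  have hbdd (x : ℝ) (hx : 0 ≤ x) := norm_diffSymbol_le_const hd hx
  set τ : ℝ := (2 * Real.pi / scale d * t) ^ 2
  have hτ : 0 < τ := by positivity
  set R := 𝓕⁻ (fun ξ => ((1 / (1 + τ * ‖ξ‖ ^ 2) : ℝ) : ℂ) * 𝓕 φ ξ) x
  have hdc : Continuous (diffSymbol d) :=
    continuous_iff_continuousAt.mpr fun x => (hasDerivAt_diffSymbol x).continuousAt
  have hsplit : schwartzValue φ t x =
      radialOp (diffSymbol d) (𝓕 φ) t x + profile d 0 * R := by
    have i1 : Integrable fun ξ : EuclideanSpace ℝ (Fin d) =>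
        Complex.exp ((2 * Real.pi * inner ℝ ξ x : ℝ) * Complex.I) •
          (diffSymbol d (t * ‖ξ‖) * 𝓕 φ ξ) := by
      refine (integrable_mul_schwartz (hdc.measurable.comp (by fun_prop))
        (fun ξ => hbdd _ (by positivity)) _).bdd_mul (c := 1)
        (Continuous.aestronglyMeasurable (by fun_prop)) (Filter.Eventually.of_forall fun ξ => ?_)
      rw [Complex.norm_exp_ofReal_mul_I]
    have i2 : Integrable fun ξ : EuclideanSpace ℝ (Fin d) =>
        Complex.exp ((2 * Real.pi * inner ℝ ξ x : ℝ) * Complex.I) •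
          (((1 / (1 + τ * ‖ξ‖ ^ 2) : ℝ) : ℂ) * 𝓕 φ ξ) := by
      refine (integrable_mul_schwartz (C := 1) (by fun_prop)
        (fun ξ => ?_) _).bdd_mul (c := 1)
        (Continuous.aestronglyMeasurable (by fun_prop)) (Filter.Eventually.of_forall fun ξ => ?_)
      · rw [Complex.norm_real, Real.norm_of_nonneg (by positivity), div_le_one (by positivity)]
        nlinarith [mul_nonneg hτ.le (sq_nonneg ‖ξ‖)]
      · rw [Complex.norm_exp_ofReal_mul_I]
    unfold schwartzValue radialOp
    simp only [R, Real.fourierInv_eq']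
    rw [← integral_const_mul, ← integral_add i1 (i2.const_mul _)]
    refine integral_congr_ae (Filter.Eventually.of_forall fun ξ => ?_)
    have h1 : resolventSymbol d (t * ‖ξ‖) = 1 / (1 + τ * ‖ξ‖ ^ 2) := by
      unfold resolventSymbol
      simp only [τ]
      ring
    simp only [diffSymbol, profileExt_eq hd (show 0 ≤ t * ‖ξ‖ by positivity), h1, smul_eq_mul]
    ring
  have h1 : ‖radialOp (diffSymbol d) (𝓕 φ) t x‖ₑ ^ 2 ≤
      squareFunction (diffSymbol d) (diffSymbolDeriv d) (𝓕 φ) x :=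
    enorm_radialOp_sq_le hasDerivAt_diffSymbol continuous_diffSymbolDeriv hbdd hC'
      diffSymbol_zero ht x
  have h2 : ‖R‖ₑ ≤ 2 * resolventMax d (fun y => ‖φ y‖ₑ) x :=
    (enorm_resolvent_le φ hτ x).trans (kernelOp_resolventKernel_le hτ _ x)
  have h3 : ‖profile d 0‖ₑ ≤ 4 := by
    rw [← ofReal_norm]
    refine (ENNReal.ofReal_le_ofReal (norm_profile_zero_le hd)).trans ?_
    norm_num
  rw [hsplit]
  calc _ ≤ (‖radialOp (diffSymbol d) (𝓕 φ) t x‖ₑ + ‖profile d 0 * R‖ₑ) ^ 2 :=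
        pow_le_pow_left' (enorm_add_le _ _) 2
    _ ≤ 2 * (‖radialOp (diffSymbol d) (𝓕 φ) t x‖ₑ ^ 2 + ‖profile d 0 * R‖ₑ ^ 2) := ennreal_add_sq_le _ _
    _ ≤ 2 * (squareFunction (diffSymbol d) (diffSymbolDeriv d) (𝓕 φ) x +
          (4 * (2 * resolventMax d (fun y => ‖φ y‖ₑ) x)) ^ 2) := by
        rw [enorm_mul]
        gcongr
    _ = _ := by ring

theorem lintegral_maximalFunction_schwartzValue_sq_le (hd : 4 ≤ d)
    (φ : 𝓢(EuclideanSpace ℝ (Fin d), ℂ)) :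
    ∫⁻ x, maximalFunction (schwartzValue φ) x ^ 2 ≤ 100 ^ 2 * ∫⁻ x, ‖φ x‖ₑ ^ 2 := by
  have hdc : Continuous (diffSymbol d) :=
    continuous_iff_continuousAt.mpr fun x => (hasDerivAt_diffSymbol x).continuousAt
  have hc : 0 ≤ 2 * Real.pi / scale d :=
    div_nonneg (by have := Real.pi_pos; positivity) (scale_pos hd).le
  have hφ : Measurable fun y => ‖φ y‖ₑ := φ.continuous.measurable.enorm
  have hsq : Measurable (squareFunction (diffSymbol d) (diffSymbolDeriv d) (𝓕 φ)) :=
    measurable_squareFunction hdc.measurable continuous_diffSymbolDeriv.measurable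
  have h1 := lintegral_squareFunction_le (ψ := 𝓕 φ) hdc continuous_diffSymbolDeriv hc
    (fun x hx => norm_diffSymbol_le_const hd hx) (fun x hx => norm_diffSymbol_le hd hx)
    (fun x hx => norm_mul_diffSymbolDeriv_le hd hx)
  have h2 := lintegral_resolventMax_sq_le (d := d) hφ
  calc ∫⁻ x, maximalFunction (schwartzValue φ) x ^ 2
      ≤ ∫⁻ x, (2 * squareFunction (diffSymbol d) (diffSymbolDeriv d) (𝓕 φ) x +
        128 * resolventMax d (fun y => ‖φ y‖ₑ) x ^ 2) := by
        refine lintegral_mono fun x => ?_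
        rw [maximalFunction, ENNReal.iSup_pow]
        exact iSup_le fun t => enorm_schwartzValue_sq_le hd φ t x
    _ = 2 * (∫⁻ x, squareFunction (diffSymbol d) (diffSymbolDeriv d) (𝓕 φ) x) +
        128 * ∫⁻ x, resolventMax d (fun y => ‖φ y‖ₑ) x ^ 2 := by
        rw [lintegral_add_left (hsq.const_mul _), lintegral_const_mul _ hsq,
          lintegral_const_mul _ ((measurable_resolventMax hφ).pow_const 2)]
    -- Here 256 = 16² comes from the bounds on b and xb', and 66 from the chain of resolvents.
    _ ≤ 2 * (256 * ∫⁻ x, ‖φ x‖ₑ ^ 2) + 128 * (66 * ∫⁻ x, ‖φ x‖ₑ ^ 2) := by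
        gcongr
        rw [lintegral_fourier_sq] at h1
        convert! h1 using 2
        norm_num
    _ = 8960 * ∫⁻ x, ‖φ x‖ₑ ^ 2 := by ring
    _ ≤ _ := by
        gcongr
        norm_num

/-! ### Extension to `L²` -/

theorem IsContinuousVersion.ae_forall_eq
    {f : Lp ℂ 2 (volume : Measure (EuclideanSpace ℝ (Fin d)))}
    {F G : Set.Ioi (0 : ℝ) → EuclideanSpace ℝ (Fin d) → ℂ}
    (hF : IsContinuousVersion f F) (hG : IsContinuousVersion f G) :
    ∀ᵐ x, ∀ t, F t x = G t x := by
  obtain ⟨D, hDc, hDd⟩ := TopologicalSpace.exists_countable_dense (Set.Ioi (0 : ℝ))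
  have h : ∀ᵐ x, ∀ t ∈ D, F t x = G t x :=
    (ae_ball_iff hDc).mpr fun t _ => (hF.ae_eq t).trans (hG.ae_eq t).symm
  filter_upwards [h, hF.continuous, hG.continuous] with x h1 h2 h3
  exact fun t => congrFun (h2.ext_on hDd h3 h1) t

/-- By continuity in t the supremum over a countable dense set is the full one almost everywhere. -/
theorem IsContinuousVersion.aemeasurable_maximalFunction
    {f : Lp ℂ 2 (volume : Measure (EuclideanSpace ℝ (Fin d)))}
    {F : Set.Ioi (0 : ℝ) → EuclideanSpace ℝ (Fin d) → ℂ} (hF : IsContinuousVersion f F) :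
    AEMeasurable (maximalFunction F) volume := by
  obtain ⟨D, hDc, hDd⟩ := TopologicalSpace.exists_countable_dense (Set.Ioi (0 : ℝ))
  have hm : AEMeasurable (fun x => ⨆ t ∈ D, ‖F t x‖ₑ) volume :=
    AEMeasurable.biSup D hDc fun t _ =>
      (((Lp.aestronglyMeasurable _).congr (hF.ae_eq t).symm).enorm)
  refine hm.congr ?_
  filter_upwards [hF.continuous] with x hx
  refine le_antisymm (iSup₂_le fun t _ => le_iSup (fun t => ‖F t x‖ₑ) t) (iSup_le fun t => ?_)
  have hcl : IsClosed {t | ‖F t x‖ₑ ≤ ⨆ t ∈ D, ‖F t x‖ₑ} :=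
    isClosed_le hx.enorm continuous_const
  have hsub : closure D ⊆ {t | ‖F t x‖ₑ ≤ ⨆ t ∈ D, ‖F t x‖ₑ} :=
    closure_minimal (fun t ht => le_iSup₂ (f := fun t _ => ‖F t x‖ₑ) t ht) hcl
  exact hsub (hDd t)

/-- The constant may depend on t: it only serves to identify, for each fixed t, the pointwise limit
with the class of M^t f. -/
theorem exists_norm_multiplierOp_sub_le (t : Set.Ioi (0 : ℝ)) :
    ∃ C : ℝ, ∀ f g : Lp ℂ 2 (volume : Measure (EuclideanSpace ℝ (Fin d))),
      ‖multiplierOp t f - multiplierOp t g‖ ≤ C * ‖f - g‖ := by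
  set σ : Lp ℂ ∞ (volume : Measure (EuclideanSpace ℝ (Fin d))) := (memLp_symbol t).toLp _
  refine ⟨‖σ‖, fun f g => ?_⟩
  set m : Lp ℂ 2 (volume : Measure (EuclideanSpace ℝ (Fin d))) :=
    multiplierOp t f - multiplierOp t g
  have h1 : 𝓕 m = (σ • 𝓕 (f - g) : Lp ℂ 2 (volume : Measure (EuclideanSpace ℝ (Fin d)))) := by
    have e (f : Lp ℂ 2 (volume : Measure (EuclideanSpace ℝ (Fin d)))) : 𝓕 (multiplierOp t f) =
        (σ • 𝓕 f : Lp ℂ 2 (volume : Measure (EuclideanSpace ℝ (Fin d)))) :=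
      fourier_fourierInv_eq _
    have hsub (f g : Lp ℂ 2 (volume : Measure (EuclideanSpace ℝ (Fin d)))) :
        (𝓕 (f - g) : Lp ℂ 2 (volume : Measure (EuclideanSpace ℝ (Fin d)))) = 𝓕 f - 𝓕 g :=
      (Lp.fourierTransformₗᵢ (EuclideanSpace ℝ (Fin d)) ℂ).map_sub f g
    rw [hsub, hsub, e, e, sub_eq_add_neg, sub_eq_add_neg, Lp.add_smul, Lp.smul_neg]
  rw [← Lp.norm_fourier_eq m, h1, ← Lp.norm_fourier_eq (f - g)]
  exact Lp.norm_smul_le _ _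

theorem exists_schwartz_norm_sub_lt (f : Lp ℂ 2 (volume : Measure (EuclideanSpace ℝ (Fin d))))
    {ε : ℝ} (hε : 0 < ε) :
    ∃ φ : 𝓢(EuclideanSpace ℝ (Fin d), ℂ), ‖φ.toLp 2 volume - f‖ < ε := by
  have h := SchwartzMap.denseRange_toLpCLM (E := EuclideanSpace ℝ (Fin d)) (F := ℂ)
    (μ := volume) (p := 2) (by norm_num)
  obtain ⟨φ, hφ⟩ := h.exists_dist_lt f hε
  refine ⟨φ, ?_⟩
  rw [dist_comm, dist_eq_norm] at hφ
  exact hφ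

theorem lintegral_enorm_sq_eq (φ : 𝓢(EuclideanSpace ℝ (Fin d), ℂ)) :
    ∫⁻ x, ‖φ x‖ₑ ^ 2 = ‖φ.toLp 2 volume‖ₑ ^ 2 := by
  rw [Lp.enorm_def, eLpNorm_congr_ae (φ.coeFn_toLp 2 volume), eLpNorm_two_sq]

/-- The continuous version, together with pointwise approximation by Schwartz functions. -/
theorem exists_isContinuousVersion (hd : 4 ≤ d)
    (f : Lp ℂ 2 (volume : Measure (EuclideanSpace ℝ (Fin d)))) :
    ∃ (φ : ℕ → 𝓢(EuclideanSpace ℝ (Fin d), ℂ))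
      (F : Set.Ioi (0 : ℝ) → EuclideanSpace ℝ (Fin d) → ℂ),
      Filter.Tendsto (fun n => (φ n).toLp 2 volume) Filter.atTop (nhds f) ∧
      (∀ᵐ x, ∀ t, Filter.Tendsto (fun n => schwartzValue (φ n) t x) Filter.atTop
        (nhds (F t x))) ∧ IsContinuousVersion f F := by
  choose φ hφ using fun n : ℕ => exists_schwartz_norm_sub_lt f
    (show (0 : ℝ) < 4⁻¹ ^ n by positivity)
  have hlim : Filter.Tendsto (fun n => (φ n).toLp 2 volume) Filter.atTop (nhds f) := by
    rw [tendsto_iff_norm_sub_tendsto_zero]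
    exact squeeze_zero (fun n => norm_nonneg _) (fun n => (hφ n).le)
      (tendsto_pow_atTop_nhds_zero_of_lt_one (by norm_num) (by norm_num))
  set δ : ℕ → 𝓢(EuclideanSpace ℝ (Fin d), ℂ) := fun n => φ (n + 1) - φ n
  set M : ℕ → EuclideanSpace ℝ (Fin d) → ℝ≥0∞ := fun n => maximalFunction (schwartzValue (δ n))
  have hM (n) : Measurable (M n) := measurable_maximalFunction_schwartzValue _
  have hδ (n) : ‖(δ n).toLp 2 volume‖ ≤ 2 * 4⁻¹ ^ n := by
    have e : (δ n).toLp 2 volume = (φ (n + 1)).toLp 2 volume - (φ n).toLp 2 volume :=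
      (SchwartzMap.toLpCLM ℂ (E := EuclideanSpace ℝ (Fin d)) ℂ 2 volume).map_sub _ _
    rw [e, ← sub_sub_sub_cancel_right _ _ f]
    refine (norm_sub_le _ _).trans ?_
    have h1 := (hφ (n + 1)).le
    have h2 := (hφ n).le
    have h3 : (4⁻¹ : ℝ) ^ (n + 1) ≤ 4⁻¹ ^ n :=
      pow_le_pow_of_le_one (by norm_num) (by norm_num) n.le_succ
    linarith
  -- The increments have norm at most 2 · 4⁻ⁿ, so even with the weight 2ⁿ the squares are summable:
  -- 2ⁿ · 100² · 4 · 16⁻ⁿ = 40000 · 8⁻ⁿ.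
  have hMint (n) : ∫⁻ x, 2 ^ n * M n x ^ 2 ≤ ENNReal.ofReal (40000 * 8⁻¹ ^ n) := by
    rw [lintegral_const_mul _ ((hM n).pow_const 2)]
    calc _ ≤ 2 ^ n * (100 ^ 2 * ∫⁻ x, ‖δ n x‖ₑ ^ 2) := by
          gcongr
          exact lintegral_maximalFunction_schwartzValue_sq_le hd _
      _ ≤ 2 ^ n * (100 ^ 2 * ENNReal.ofReal (2 * 4⁻¹ ^ n) ^ 2) := by
          rw [lintegral_enorm_sq_eq]
          gcongr
          rw [← ofReal_norm]
          exact ENNReal.ofReal_le_ofReal (hδ n)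
      _ = ENNReal.ofReal (2 ^ n * (100 ^ 2 * (2 * 4⁻¹ ^ n) ^ 2)) := by
          rw [ENNReal.ofReal_mul (p := 2 ^ n) (by positivity),
            ENNReal.ofReal_mul (p := 100 ^ 2) (by positivity),
            ENNReal.ofReal_pow (p := 2 * 4⁻¹ ^ n) (by positivity),
            ENNReal.ofReal_pow (p := 2) (by positivity)]
          norm_num
      _ ≤ _ := by
          refine ENNReal.ofReal_le_ofReal (le_of_eq ?_)
          rw [mul_pow, ← pow_mul, mul_comm n 2, pow_mul, show (8⁻¹ : ℝ) = 2 * 4⁻¹ ^ 2 by norm_num,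
            mul_pow]
          ring
  have hsum : ∀ᵐ x, ∑' n, M n x < ∞ := by
    have h1 : ∫⁻ x, ∑' n, 2 ^ n * M n x ^ 2 ≠ ∞ := by
      rw [lintegral_tsum fun n => (((hM n).pow_const 2).const_mul _).aemeasurable]
      refine ne_top_of_le_ne_top ?_ (ENNReal.tsum_le_tsum hMint)
      rw [← ENNReal.ofReal_tsum_of_nonneg (fun n => by positivity)
        ((summable_geometric_of_lt_one (by norm_num) (by norm_num)).mul_left _)]
      exact ENNReal.ofReal_ne_top
    have h2 : Measurable fun x => ∑' n, 2 ^ n * M n x ^ 2 :=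
      Measurable.tsum fun n => ((hM n).pow_const 2).const_mul _
    filter_upwards [ae_lt_top h2 h1] with x hx
    -- Either M_n ≤ 2⁻ⁿ or 1 ≤ 2ⁿ M_n; this passes from summable weighted squares to a summable
    -- series, hence to convergence uniform in t.
    have h3 (n) : M n x ≤ 2⁻¹ ^ n + 2 ^ n * M n x ^ 2 := by
      rcases le_total (M n x) (2⁻¹ ^ n) with h | h
      · exact h.trans le_self_add
      · refine le_trans ?_ le_add_self
        calc M n x = 2 ^ n * (M n x * 2⁻¹ ^ n) := by
              rw [mul_left_comm, ← mul_pow, ENNReal.mul_inv_cancel (by norm_num) (by norm_num),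
                one_pow, mul_one]
          _ ≤ 2 ^ n * (M n x * M n x) := by gcongr
          _ = _ := by rw [sq]
    refine (ENNReal.tsum_le_tsum h3).trans_lt ?_
    rw [ENNReal.tsum_add, ENNReal.tsum_geometric]
    refine ENNReal.add_lt_top.mpr ⟨?_, hx⟩
    rw [ENNReal.one_sub_inv_two, inv_inv]
    norm_num
  set F : Set.Ioi (0 : ℝ) → EuclideanSpace ℝ (Fin d) → ℂ := fun t x =>
    schwartzValue (φ 0) t x + ∑' n, schwartzValue (δ n) t x
  have hgood : ∀ᵐ x, (∀ t, Filter.Tendsto (fun n => schwartzValue (φ n) t x) Filter.atTop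
      (nhds (F t x))) ∧ Continuous fun t => F t x := by
    filter_upwards [hsum] with x hx
    have hfin (n) : M n x ≠ ∞ := ne_top_of_le_ne_top hx.ne (ENNReal.le_tsum n)
    have hu : Summable fun n => (M n x).toReal := ENNReal.summable_toReal hx.ne
    have hle (n) (t : Set.Ioi (0 : ℝ)) : ‖schwartzValue (δ n) t x‖ ≤ (M n x).toReal := by
      rw [← toReal_enorm]
      exact ENNReal.toReal_mono (hfin n) (le_iSup (fun t => ‖schwartzValue (δ n) t x‖ₑ) t)
    refine ⟨fun t => ?_, (continuous_schwartzValue hd _ x).add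
      (continuous_tsum (fun n => continuous_schwartzValue hd _ x) hu hle)⟩
    have h1 := (Summable.of_norm_bounded hu fun n => hle n t).hasSum.tendsto_sum_nat
    have h2 := h1.const_add (schwartzValue (φ 0) t x)
    refine h2.congr fun n => ?_
    simp only [δ, schwartzValue_sub]
    rw [Finset.sum_range_sub (fun n => schwartzValue (φ n) t x)]
    ring
  refine ⟨φ, F, hlim, hgood.mono fun x hx => hx.1, fun t => ?_, hgood.mono fun x hx => hx.2⟩
  obtain ⟨C, hC⟩ := exists_norm_multiplierOp_sub_le (d := d) t
  have hL2 : Filter.Tendsto (fun n => multiplierOp t ((φ n).toLp 2 volume)) Filter.atTop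
      (nhds (multiplierOp t f)) := by
    rw [tendsto_iff_norm_sub_tendsto_zero] at hlim ⊢
    have h3 := hlim.const_mul C
    rw [mul_zero] at h3
    exact squeeze_zero (fun n => norm_nonneg _) (fun n => hC _ _) h3
  -- L² convergence gives almost everywhere convergence along a subsequence, which must agree with
  -- the pointwise limit F.
  obtain ⟨ns, hns, hae⟩ := (tendstoInMeasure_of_tendsto_Lp hL2).exists_seq_tendsto_ae
  have hall : ∀ᵐ x, ∀ n, schwartzValue (φ n) t x = multiplierOp t ((φ n).toLp 2 volume) x :=
    ae_all_iff.mpr fun n => schwartzValue_ae_eq (φ n) t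
  filter_upwards [hgood, hae, hall] with x h1 h2 h3
  refine tendsto_nhds_unique ((h1.1 t).comp hns.tendsto_atTop) (h2.congr fun n => ?_)
  exact (h3 (ns n)).symm

/-- Values converge at all t simultaneously for almost every x, so the maximal function of the limit
is at most the liminf of those of the approximants. Fatou's lemma concludes, and uniqueness of
continuous versions covers an arbitrary G. -/
theorem lintegral_maximalFunction_sq_le (hd : 4 ≤ d)
    {f : Lp ℂ 2 (volume : Measure (EuclideanSpace ℝ (Fin d)))}
    {G : Set.Ioi (0 : ℝ) → EuclideanSpace ℝ (Fin d) → ℂ} (hG : IsContinuousVersion f G) :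
    ∫⁻ x, maximalFunction G x ^ 2 ≤ 100 ^ 2 * eLpNorm f 2 volume ^ 2 := by
  obtain ⟨φ, F, hlim, hpt, hF⟩ := exists_isContinuousVersion hd f
  have h1 : ∀ᵐ x, maximalFunction G x ^ 2 ≤
      Filter.liminf (fun n => maximalFunction (schwartzValue (φ n)) x ^ 2) Filter.atTop := by
    filter_upwards [hpt, hG.ae_forall_eq hF] with x hx hGF
    rw [maximalFunction, ENNReal.iSup_pow]
    refine iSup_le fun t => ?_
    rw [hGF t]
    have h2 : Filter.Tendsto (fun n => ‖schwartzValue (φ n) t x‖ₑ ^ 2) Filter.atTop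
        (nhds (‖F t x‖ₑ ^ 2)) :=
      (((ENNReal.continuous_pow 2).comp continuous_enorm).tendsto _).comp (hx t)
    rw [← h2.liminf_eq]
    exact Filter.liminf_le_liminf (Filter.Eventually.of_forall fun n =>
      pow_le_pow_left' (le_iSup (fun t => ‖schwartzValue (φ n) t x‖ₑ) t) 2)
  have h3 : Filter.Tendsto (fun n => 100 ^ 2 * ‖(φ n).toLp 2 volume‖ₑ ^ 2) Filter.atTop
      (nhds (100 ^ 2 * ‖f‖ₑ ^ 2)) := by
    refine ENNReal.Tendsto.const_mul ?_ (Or.inr (by norm_num))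
    exact (((ENNReal.continuous_pow 2).comp continuous_enorm).tendsto f).comp hlim
  calc _ ≤ ∫⁻ x, Filter.liminf (fun n => maximalFunction (schwartzValue (φ n)) x ^ 2)
        Filter.atTop := lintegral_mono_ae h1
    _ ≤ Filter.liminf (fun n => ∫⁻ x, maximalFunction (schwartzValue (φ n)) x ^ 2)
        Filter.atTop := lintegral_liminf_le fun n =>
          (measurable_maximalFunction_schwartzValue (φ n)).pow_const 2
    _ ≤ Filter.liminf (fun n => 100 ^ 2 * ‖(φ n).toLp 2 volume‖ₑ ^ 2) Filter.atTop := by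
        refine Filter.liminf_le_liminf (Filter.Eventually.of_forall fun n => ?_)
        rw [← lintegral_enorm_sq_eq]
        exact lintegral_maximalFunction_schwartzValue_sq_le hd (φ n)
    _ = _ := by rw [h3.liminf_eq, Lp.enorm_def]

theorem eLpNorm_maximalFunction_le (hd : 4 ≤ d)
    {f : Lp ℂ 2 (volume : Measure (EuclideanSpace ℝ (Fin d)))}
    {G : Set.Ioi (0 : ℝ) → EuclideanSpace ℝ (Fin d) → ℂ} (hG : IsContinuousVersion f G) :
    eLpNorm (maximalFunction G) 2 volume ≤ 100 * eLpNorm f 2 volume := by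
  refine (ENNReal.pow_le_pow_left_iff two_ne_zero).mp ?_
  rw [mul_pow, eLpNorm_two_sq]
  simpa only [enorm_eq_self] using lintegral_maximalFunction_sq_le hd hG

end RieszMaximal

end

theorem mainTheorem2 (d : ℕ) (hd : 4 ≤ d) :
    (∀ φ : 𝓢(EuclideanSpace ℝ (Fin d), ℂ),
      RieszMaximal.IsContinuousVersion (φ.toLp 2 volume) (RieszMaximal.schwartzValue φ)) ∧
    ∀ f : Lp ℂ 2 (volume : Measure (EuclideanSpace ℝ (Fin d))),
      (∃ F, RieszMaximal.IsContinuousVersion f F) ∧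
      ∀ F, RieszMaximal.IsContinuousVersion f F →
        AEMeasurable (RieszMaximal.maximalFunction F) volume ∧
        eLpNorm (RieszMaximal.maximalFunction F) 2 volume ≤ 2 * 10 ^ 8 * eLpNorm f 2 volume := by
  refine ⟨RieszMaximal.isContinuousVersion_schwartzValue hd, fun f => ⟨?_, fun F hF => ⟨?_, ?_⟩⟩⟩
  · obtain ⟨φ, F, _, _, hF⟩ := RieszMaximal.exists_isContinuousVersion hd f
    exact ⟨F, hF⟩
  · exact hF.aemeasurable_maximalFunction
  -- The argument yields the constant 100, well below the one claimed.
  · refine (RieszMaximal.eLpNorm_maximalFunction_le hd hF).trans ?_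
    gcongr
    norm_num
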